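/- Let $g\in C^2(\mathbb R)$ be bounded and strictly increasing, with exactly one inflection point $x_0\in\mathbb R$, in the sense that $g$ is strictly convex on one of the half-lines $(-\infty,x_0]$, $[x_0,+\infty)$ and strictly concave on the other one; put $g(\pm\infty)=\lim_{s\to\pm\infty}g(s)$. Let $p:\mathbb R\to\mathbb R$ be bounded and continuous, and suppose that it has an asymptotic average $A(p)\in\mathbb R$, that is, $$\lim_{T\to+\infty}\frac1T\int_t^{t+T}p(s)\,ds=A(p)\qquad\text{uniformly in }t\in\mathbb R.$$ Consider the equation $$\ddot u+g(u)=p(t)\qquad(\ast)$$ and its solutions $u\in C^2(\mathbb R)$ defined on the whole line. Then the following are equivalent: (i) $(\ast)$ has a solution which is bounded on $\mathbb R$; (ii) $(\ast)$ has a solution which is bounded on $\mathbb R$ together with its first derivative; (iii) $g(-\infty)<A(p)<g(+\infty)$. If (iii) holds, there is a sequence $(u_m)$ of solutions of $(\ast)$ on $\mathbb R$, each bounded together with its first derivative, with $\|u_m\|_\infty=\sup_{t\in\mathbb R}|u_m(t)|\to\infty$ as $m\to\infty$, and such that each $u_m$ has infinitely many zeros and also takes the value $x_0$ infinitely many times (these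 two properties coincide under the normalization $x_0=0$). -/

import Mathlib

open Set Filter Topology

/-- A real function is bounded on the whole line. -/
def IsBoundedFun (f : ℝ → ℝ) : Prop :=
  ∃ M : ℝ, ∀ t : ℝ, |f t| ≤ M

/-- `x₀` is the one and only inflection point of `g : ℝ → ℝ`: the function `g` is strictly convex on
one side of `x₀` and strictly concave on the other side. -/
def IsOnlyInflectionPoint (g : ℝ → ℝ) (x₀ : ℝ) : Prop :=
  (StrictConvexOn ℝ (Iic x₀) g ∧ StrictConcaveOn ℝ (Ici x₀) g) ∨
    (StrictConcaveOn ℝ (Iic x₀) g ∧ StrictConvexOn ℝ (Ici x₀) g)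

/-- `A` is the asymptotic average of `p`: the mean of `p` over `[t, t + T]` tends to `A` as
`T → +∞`, uniformly in `t ∈ ℝ`. -/
def HasAsymptoticAverage (p : ℝ → ℝ) (A : ℝ) : Prop :=
  TendstoUniformly (fun T t : ℝ => (1 / T) * ∫ s in t..(t + T), p s) (fun _ => A) atTop

/-- `u` is a (classical) solution of `ü + g(u) = p(t)` on the whole real line. -/
def IsSolution (g p u : ℝ → ℝ) : Prop :=
  ContDiff ℝ 2 u ∧ ∀ t : ℝ, deriv (deriv u) t + g (u t) = p t

/-!
Necessity: if `u` is bounded then so is `u̇`, hence the mean of `p - g(u) = ü` over `[0, T]` tends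
to `0`, while the mean of `g(u)` stays in a compact part of the range of `g`.

Sufficiency: after a translation `x₀ = 0` and `A(p) = 0`, so that `g` is concave above the axis,
convex below it, and `g(-∞) < 0 < g(+∞)`. On every long interval `[a, b]` the Dirichlet problem has
exactly one solution close to the parabola `g(+∞) (t - a)(b - t) / 2`, and likewise one close to a
parabola below the axis; concavity gives the comparison principle behind uniqueness and continuous
dependence. Up to a small relative error, the action of such an arc is a negative multiple of
`(b - a) ^ 3`; its derivatives with respect to `b` and `a` are `-u̇ ^ 2 / 2` and `u̇ ^ 2 / 2` at the
respective endpoint. Alternate arcs above and below the axis along a subdivision of a given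
interval, and minimise, over all subdivisions into long gaps, minus the total action plus a fixed
penalty per gap. The cube is superadditive, which rules out gaps that are too long, and the penalty
rules out gaps that are too short; so the minimum is attained at an interior subdivision. There
adjacent arcs have the same slope and fit together to a solution. As the gaps stay in a range which
does not depend on the interval, a limit along growing intervals is a bounded solution oscillating
between large positive and large negative values.
-/

/-- `t 0 = a`, …, `t n = b` is a subdivision of `[a, b]` with gaps at least `τ`. The values
`t i` with `i > n` are irrelevant. -/
structure IsSubdivision (τ a b : ℝ) (n : ℕ) (t : ℕ → ℝ) : Prop where
  left : t 0 = a
  right : t n = b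
  gap : ∀ k < n, τ ≤ t (k + 1) - t k

/-- The cost of a subdivision whose `i`-th gap `[x, y]` costs `f i x y`, plus a price `μ`. -/
def subdivisionCost (f : ℕ → ℝ → ℝ → ℝ) (μ : ℝ) (n : ℕ) (t : ℕ → ℝ) : ℝ :=
  ∑ i ∈ Finset.range n, (f i (t i) (t (i + 1)) + μ)

/-- The subdivision with `n` gaps `s`, followed by the subdivision `t`. -/
def concatSubdivision (n : ℕ) (s t : ℕ → ℝ) (i : ℕ) : ℝ :=
  if i ≤ n then s i else t (i - n)

/-- A subdivision of least cost, whatever the number of gaps. -/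
structure IsMinSubdivision (f : ℕ → ℝ → ℝ → ℝ) (μ τ a b : ℝ) (n : ℕ) (t : ℕ → ℝ) : Prop
    extends IsSubdivision τ a b n t where
  cost_le : ∀ n' t', IsSubdivision τ a b n' t' → subdivisionCost f μ n t ≤ subdivisionCost f μ n' t'

section Subdivision

variable {f : ℕ → ℝ → ℝ → ℝ} {μ τ a b c : ℝ} {k m n : ℕ} {s t : ℕ → ℝ}

lemma subdivisionCost_add (f : ℕ → ℝ → ℝ → ℝ) (μ : ℝ) (n m : ℕ) (t : ℕ → ℝ) :
    subdivisionCost f μ (n + m) t =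
      subdivisionCost f μ n t + subdivisionCost (fun i => f (n + i)) μ m fun i => t (n + i) :=
  Finset.sum_range_add _ n m

lemma subdivisionCost_congr (h : ∀ i ≤ n, s i = t i) :
    subdivisionCost f μ n s = subdivisionCost f μ n t :=
  Finset.sum_congr rfl fun i hi => by
    rw [h i (Finset.mem_range.mp hi).le, h (i + 1) (Finset.mem_range.mp hi)]

lemma concatSubdivision_of_le {i : ℕ} (hi : i ≤ n) : concatSubdivision n s t i = s i := if_pos hi

lemma concatSubdivision_add (h : s n = t 0) (i : ℕ) : concatSubdivision n s t (n + i) = t i := by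
  rcases Nat.eq_zero_or_pos i with rfl | hi
  · rw [add_zero, concatSubdivision_of_le le_rfl, h]
  · rw [concatSubdivision, if_neg (by omega), Nat.add_sub_cancel_left]

lemma subdivisionCost_concat (h : s n = t 0) (m : ℕ) :
    subdivisionCost f μ (n + m) (concatSubdivision n s t) =
      subdivisionCost f μ n s + subdivisionCost (fun i => f (n + i)) μ m t := by
  simp only [subdivisionCost_add, concatSubdivision_add h]
  rw [subdivisionCost_congr fun i hi => concatSubdivision_of_le hi]

namespace IsSubdivision

lemma concat (hs : IsSubdivision τ a b n s) (ht : IsSubdivision τ b c m t) :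
    IsSubdivision τ a c (n + m) (concatSubdivision n s t) := by
  have hst : s n = t 0 := hs.right.trans ht.left.symm
  refine ⟨?_, ?_, fun k hk => ?_⟩
  · rw [concatSubdivision_of_le n.zero_le, hs.left]
  · rw [concatSubdivision_add hst, ht.right]
  · rcases Nat.lt_or_ge k n with hkn | hkn
    · rw [concatSubdivision_of_le hkn, concatSubdivision_of_le hkn.le]
      exact hs.gap k hkn
    · obtain ⟨i, rfl⟩ := Nat.exists_eq_add_of_le hkn
      rw [add_assoc, concatSubdivision_add hst, concatSubdivision_add hst]
      exact ht.gap i (by omega)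

lemma take (h : IsSubdivision τ a b n t) (hk : k ≤ n) : IsSubdivision τ a (t k) k t :=
  ⟨h.left, rfl, fun i hi => h.gap i (by omega)⟩

lemma drop (h : IsSubdivision τ a b (k + m) t) : IsSubdivision τ (t k) b m fun i => t (k + i) :=
  ⟨rfl, h.right, fun i hi => h.gap (k + i) (by omega)⟩

lemma le_of_le (hτ : 0 ≤ τ) (h : IsSubdivision τ a b n t) {i j : ℕ} (hij : i ≤ j) (hj : j ≤ n) :
    t i ≤ t j := by
  induction j, hij using Nat.le_induction with
  | base => exact le_rfl
  | succ j _ ih => linarith [ih (by omega), h.gap j (by omega)]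

lemma mul_le (h : IsSubdivision τ a b n t) : n * τ ≤ b - a := by
  have := Finset.sum_le_sum (s := Finset.range n) (f := fun _ => τ)
    (g := fun i => t (i + 1) - t i) fun i hi => h.gap i (Finset.mem_range.mp hi)
  rw [Finset.sum_range_sub, h.left, h.right] at this
  simpa using this

lemma le_mul_of_gap_le {D : ℝ} (h : IsSubdivision τ a b n t)
    (hD : ∀ k < n, t (k + 1) - t k ≤ D) : b - a ≤ n * D := by
  have := Finset.sum_le_sum (s := Finset.range n) (f := fun i => t (i + 1) - t i)
    (g := fun _ => D) fun i hi => hD i (Finset.mem_range.mp hi)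
  rw [Finset.sum_range_sub, h.left, h.right] at this
  simpa using this

lemma of_one (hab : τ ≤ b - a) : IsSubdivision τ a b 1 fun i => if i = 0 then a else b :=
  ⟨rfl, rfl, fun k hk => by simpa [Nat.lt_one_iff.mp hk] using hab⟩

lemma isClosed_setOf (τ a b : ℝ) (n : ℕ) : IsClosed {t : ℕ → ℝ | IsSubdivision τ a b n t} := by
  have : {t : ℕ → ℝ | IsSubdivision τ a b n t} =
      {t | t 0 = a} ∩ ({t | t n = b} ∩ ⋂ k, ⋂ (_ : k < n), {t | τ ≤ t (k + 1) - t k}) := by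
    ext t
    simp only [mem_ofPred_eq, mem_inter_iff, mem_iInter]
    exact ⟨fun h => ⟨h.left, h.right, h.gap⟩, fun h => ⟨h.1, h.2.1, h.2.2⟩⟩
  rw [this]
  refine (isClosed_eq (by fun_prop) (by fun_prop)).inter
    ((isClosed_eq (by fun_prop) (by fun_prop)).inter ?_)
  exact isClosed_iInter fun k => isClosed_iInter fun _ => isClosed_le (by fun_prop) (by fun_prop)

lemma min_index (hτ : 0 ≤ τ) (h : IsSubdivision τ a b n t) :
    IsSubdivision τ a b n (fun i => t (min i n)) ∧ ∀ i, t (min i n) ∈ Icc a b := by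
  refine ⟨⟨by simpa using h.left, by simpa using h.right, fun k hk => ?_⟩, fun i => ⟨?_, ?_⟩⟩
  · simpa only [min_eq_left hk.le, min_eq_left (Nat.succ_le_of_lt hk)] using h.gap k hk
  · rw [← h.left]; exact h.le_of_le hτ (Nat.zero_le _) (min_le_right _ _)
  · rw [← h.right]; exact h.le_of_le hτ (min_le_right _ _) le_rfl

lemma exists_min_of_length (hτ : 0 ≤ τ)
    (hf : ∀ k, ContinuousOn (fun q : ℝ × ℝ => f k q.1 q.2) {q | τ ≤ q.2 - q.1}) (μ : ℝ) (n : ℕ)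
    (hne : ∃ t, IsSubdivision τ a b n t) :
    ∃ t, IsSubdivision τ a b n t ∧
      ∀ t', IsSubdivision τ a b n t' → subdivisionCost f μ n t ≤ subdivisionCost f μ n t' := by
  have hcomp : IsCompact ((univ.pi fun _ => Icc a b) ∩ {t : ℕ → ℝ | IsSubdivision τ a b n t}) :=
    (isCompact_univ_pi fun _ => isCompact_Icc).inter_right (isClosed_setOf τ a b n)
  have hcont : ContinuousOn (subdivisionCost f μ n)
      ((univ.pi fun _ => Icc a b) ∩ {t | IsSubdivision τ a b n t}) := by
    unfold subdivisionCost
    refine continuousOn_finsetSum _ fun i hi => ContinuousOn.add ?_ continuousOn_const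
    exact (hf i).comp (f := fun t : ℕ → ℝ => (t i, t (i + 1))) (by fun_prop)
      fun t ht => ht.2.gap i (Finset.mem_range.mp hi)
  obtain ⟨t₀, ht₀⟩ := hne
  have h₀ := ht₀.min_index hτ
  obtain ⟨t, ht, hmin⟩ := hcomp.exists_isMinOn ⟨_, fun i _ => h₀.2 i, h₀.1⟩ hcont
  refine ⟨t, ht.2, fun t' ht' => ?_⟩
  have h' := ht'.min_index hτ
  calc subdivisionCost f μ n t ≤ subdivisionCost f μ n fun i => t' (min i n) :=
        hmin ⟨fun i _ => h'.2 i, h'.1⟩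
    _ = subdivisionCost f μ n t' := subdivisionCost_congr fun i hi => by rw [min_eq_left hi]

end IsSubdivision

lemma exists_isMinSubdivision (hτ : 0 < τ)
    (hf : ∀ k, ContinuousOn (fun q : ℝ × ℝ => f k q.1 q.2) {q | τ ≤ q.2 - q.1}) (μ : ℝ)
    (hab : τ ≤ b - a) : ∃ n t, IsMinSubdivision f μ τ a b n t := by
  classical
  set N := (Finset.range (⌊(b - a) / τ⌋₊ + 1)).filter fun n => ∃ t, IsSubdivision τ a b n t
  have hmem : ∀ n t, IsSubdivision τ a b n t → n ∈ N := by
    intro n t h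
    refine Finset.mem_filter.mpr ⟨Finset.mem_range.mpr (Nat.lt_succ_of_le (Nat.le_floor ?_)), t, h⟩
    rw [le_div_iff₀ hτ]
    exact h.mul_le
  choose! T hT hTmin using fun n (hn : ∃ t, IsSubdivision τ a b n t) =>
    IsSubdivision.exists_min_of_length hτ.le hf μ n hn
  obtain ⟨n, hn, hmin⟩ :=
    N.exists_min_image (fun n => subdivisionCost f μ n (T n)) ⟨1, hmem _ _ (.of_one hab)⟩
  exact ⟨n, T n, hT n (Finset.mem_filter.mp hn).2, fun n' t' h' =>
    (hmin n' (hmem _ _ h')).trans (hTmin n' ⟨t', h'⟩ t' h')⟩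

namespace IsMinSubdivision

/-- The parity condition keeps the costs of the later gaps aligned. -/
lemma segment_le {m' : ℕ} (h : IsMinSubdivision f μ τ a b n t) (hf : Function.Periodic f 2)
    (hkm : k + m ≤ n) (hs : IsSubdivision τ (t k) (t (k + m)) m' s) (hm : m' % 2 = m % 2) :
    subdivisionCost (fun i => f (k + i)) μ m (fun i => t (k + i)) ≤
      subdivisionCost (fun i => f (k + i)) μ m' s := by
  obtain ⟨r, rfl⟩ := Nat.exists_eq_add_of_le hkm
  have htail : (fun i => f (k + (m' + i))) = fun i => f (k + m + i) := by
    funext i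
    rw [← hf.map_mod_nat, ← hf.map_mod_nat (k + m + i)]
    congr 1; omega
  have hle := h.cost_le _ _ <|
    (h.take (k.le_add_right m |>.trans hkm)).concat (hs.concat h.toIsSubdivision.drop)
  rw [subdivisionCost_concat (by rw [concatSubdivision_of_le m'.zero_le, hs.left]),
    subdivisionCost_concat hs.right, htail, subdivisionCost_add, subdivisionCost_add] at hle
  linarith

lemma le_insert (h : IsMinSubdivision f μ τ a b n t) (hf : Function.Periodic f 2) (hk : k < n)
    {x y : ℝ} (hx : τ ≤ x - t k) (hxy : τ ≤ y - x) (hy : τ ≤ t (k + 1) - y) :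
    f k (t k) (t (k + 1)) ≤ f k (t k) x + f (k + 1) x y + f k y (t (k + 1)) + 2 * μ := by
  have hs : IsSubdivision τ (t k) (t (k + 1)) 3
      fun i => if i = 0 then t k else if i = 1 then x else if i = 2 then y else t (k + 1) :=
    ⟨rfl, rfl, fun i hi => by interval_cases i <;> simpa⟩
  have := h.segment_le hf hk hs rfl
  simp only [subdivisionCost, Finset.sum_range_succ, Finset.sum_range_zero, add_zero, hf k] at this
  norm_num at this
  linarith

lemma remove_le (h : IsMinSubdivision f μ τ a b n t) (hf : Function.Periodic f 2)
    (hk : k + 2 < n) (hgap : τ ≤ t (k + 3) - t k) :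
    f k (t k) (t (k + 1)) + f (k + 1) (t (k + 1)) (t (k + 2)) + f k (t (k + 2)) (t (k + 3))
      + 2 * μ ≤ f k (t k) (t (k + 3)) := by
  have := h.segment_le hf (m := 3) hk (.of_one hgap) rfl
  simp only [subdivisionCost, Finset.sum_range_succ, Finset.sum_range_zero, add_zero, hf k] at this
  norm_num [add_assoc] at this
  linarith

lemma le_move (h : IsMinSubdivision f μ τ a b n t) (hf : Function.Periodic f 2)
    (hk : k + 1 < n) {s : ℝ} (h₁ : τ ≤ s - t k) (h₂ : τ ≤ t (k + 2) - s) :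
    f k (t k) (t (k + 1)) + f (k + 1) (t (k + 1)) (t (k + 2)) ≤
      f k (t k) s + f (k + 1) s (t (k + 2)) := by
  have hs : IsSubdivision τ (t k) (t (k + 2)) 2
      fun i => if i = 0 then t k else if i = 1 then s else t (k + 2) :=
    ⟨rfl, rfl, fun i hi => by interval_cases i <;> simpa⟩
  have := h.segment_le hf (m := 2) hk hs rfl
  simp only [subdivisionCost, Finset.sum_range_succ, Finset.sum_range_zero, add_zero] at this
  norm_num [add_assoc] at this
  linarith

end IsMinSubdivision

end Subdivision

/-- The costs `f k x y` of the gaps `[x, y]` alternate with the parity of `k`, and are continuous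
and within `ε (y - x) ^ 3` of `c k * (y - x) ^ 3`, with `c k ∈ [c₀, C]`, for gaps of length at
least `τ`. -/
structure IsApproxCubicCost (c₀ C ε τ : ℝ) (c : ℕ → ℝ) (f : ℕ → ℝ → ℝ → ℝ) : Prop where
  coeff_mem : ∀ k, c k ∈ Icc c₀ C
  periodic : Function.Periodic f 2
  abs_sub_le : ∀ k x y, τ ≤ y - x → |f k x y - c k * (y - x) ^ 3| ≤ ε * (y - x) ^ 3
  continuousOn : ∀ k, ContinuousOn (fun q : ℝ × ℝ => f k q.1 q.2) {q | τ ≤ q.2 - q.1}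

section Cubic

variable {C θ : ℝ}

lemma cubic_rebalance_unit_lt {cx cy r : ℝ} (hC : 0 < C) (hθ : 0 < θ) (hθ' : θ ≤ 1 / 4)
    (hx : cx ≤ C) (hy : cy ∈ Icc (4 * C * θ) C) (hr : 3 * r < θ ^ 2) :
    (cx + C * θ ^ 2 / 4) * θ ^ 3 + (cy + C * θ ^ 2 / 4) * (1 - θ) ^ 3 <
      (cy - C * θ ^ 2 / 4) * (1 - r) ^ 3 := by
  obtain ⟨hy, hy'⟩ := hy
  have hCθ2 : 0 < C * θ ^ 2 := by positivity
  have hθ2 : C * θ ^ 2 ≤ C * θ * (1 / 4) := by nlinarith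
  have hleft : (cx + C * θ ^ 2 / 4) * θ ^ 3 ≤ C * θ ^ 2 / 2 := by
    calc (cx + C * θ ^ 2 / 4) * θ ^ 3 ≤ (2 * C) * (θ ^ 2 * (1 / 4)) := by
          gcongr
          · nlinarith
          · nlinarith [sq_nonneg θ]
      _ = C * θ ^ 2 / 2 := by ring
  have hright : (1 - θ) ^ 3 ≤ 1 - θ :=
    pow_le_of_le_one (by linarith) (by linarith) (by norm_num)
  have hr₁ : r ≤ 3 := by nlinarith
  have hold : 1 - θ ^ 2 ≤ (1 - r) ^ 3 := by
    linarith [mul_nonneg (sq_nonneg r) (sub_nonneg.mpr hr₁)]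
  calc (cx + C * θ ^ 2 / 4) * θ ^ 3 + (cy + C * θ ^ 2 / 4) * (1 - θ) ^ 3
      ≤ C * θ ^ 2 / 2 + (cy + C * θ ^ 2 / 4) * (1 - θ) := by
        refine add_le_add hleft (mul_le_mul_of_nonneg_left hright ?_)
        linarith
    _ < (cy - C * θ ^ 2 / 4) * (1 - θ ^ 2) := by
        have h₁ := mul_le_mul_of_nonneg_right hy hθ.le
        have h₂ := mul_le_mul_of_nonneg_right hy' (sq_nonneg θ)
        have h₃ : 0 < C * θ ^ 2 * θ := by positivity
        have h₄ : 0 < C * θ ^ 2 * θ ^ 2 := by positivity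
        linarith
    _ ≤ (cy - C * θ ^ 2 / 4) * (1 - r) ^ 3 := by
        refine mul_le_mul_of_nonneg_left hold ?_
        linarith

/-- Moving a point which cuts off too small a gap lowers a cubic cost: this is the case
`x / (x + y) ≤ θ ^ 2 / 3`, and the move puts the point at the fraction `θ` of the interval. -/
lemma cubic_rebalance_lt {cx cy x y : ℝ} (hC : 0 < C) (hθ : 0 < θ) (hθ' : θ ≤ 1 / 4)
    (hx : cx ≤ C) (hy : cy ∈ Icc (4 * C * θ) C) (hx₀ : 0 < x) (hxy : 3 / θ ^ 2 * x < y) :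
    (cx + C * θ ^ 2 / 4) * (θ * (x + y)) ^ 3 + (cy + C * θ ^ 2 / 4) * ((1 - θ) * (x + y)) ^ 3 <
      (cy - C * θ ^ 2 / 4) * y ^ 3 := by
  have h3 : 3 * x < θ ^ 2 * y := by
    rw [div_mul_eq_mul_div, div_lt_iff₀ (by positivity)] at hxy; linarith
  have hy₀ : 0 < y := pos_of_mul_pos_right ((by positivity : 0 < 3 * x).trans h3) (by positivity)
  have hr : 3 * (x / (x + y)) < θ ^ 2 := by
    rw [← mul_div_assoc, div_lt_iff₀ (by positivity)]
    nlinarith [sq_nonneg θ]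
  calc (cx + C * θ ^ 2 / 4) * (θ * (x + y)) ^ 3 + (cy + C * θ ^ 2 / 4) * ((1 - θ) * (x + y)) ^ 3
      = ((cx + C * θ ^ 2 / 4) * θ ^ 3 + (cy + C * θ ^ 2 / 4) * (1 - θ) ^ 3) * (x + y) ^ 3 := by ring
    _ < (cy - C * θ ^ 2 / 4) * (1 - x / (x + y)) ^ 3 * (x + y) ^ 3 :=
        mul_lt_mul_of_pos_right
          (cubic_rebalance_unit_lt hC hθ hθ' hx hy hr) (by positivity)
    _ = (cy - C * θ ^ 2 / 4) * y ^ 3 := by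
        field_simp
        ring

lemma cubic_split_le {c c' D : ℝ} (hC : 0 < C) (hθ : 0 < θ) (hθ' : θ ≤ 1 / 4) (hc : 4 * C * θ ≤ c)
    (hc' : c' ≤ C) (hD : 0 ≤ D) :
    2 * ((c + C * θ ^ 2 / 4) * ((1 - θ) / 2 * D) ^ 3) + (c' + C * θ ^ 2 / 4) * (θ * D) ^ 3
      + 2 * C * θ * D ^ 3 ≤ (c - C * θ ^ 2 / 4) * D ^ 3 := by
  have hCθ : 0 < C * θ := by positivity
  have hθ2 : C * θ ^ 2 ≤ C * θ * (1 / 4) := by nlinarith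
  have hside : (c + C * θ ^ 2 / 4) * ((1 - θ) / 2) ^ 3 ≤ (c + C * θ ^ 2 / 4) * (1 / 8) := by
    refine mul_le_mul_of_nonneg_left ?_ (by nlinarith)
    calc ((1 - θ) / 2) ^ 3 ≤ (1 / 2) ^ 3 := by gcongr <;> linarith
      _ = 1 / 8 := by norm_num
  have hmid : (c' + C * θ ^ 2 / 4) * θ ^ 3 ≤ C * θ / 8 := by
    calc (c' + C * θ ^ 2 / 4) * θ ^ 3 ≤ (2 * C) * (θ * (1 / 16)) := by
          gcongr
          · nlinarith
          · nlinarith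
      _ = C * θ / 8 := by ring
  have h := mul_le_mul_of_nonneg_right (show 2 * ((c + C * θ ^ 2 / 4) * ((1 - θ) / 2) ^ 3)
    + (c' + C * θ ^ 2 / 4) * θ ^ 3 + 2 * C * θ ≤ c - C * θ ^ 2 / 4 by linarith) (pow_nonneg hD 3)
  rw [mul_pow, mul_pow]
  linarith

lemma le_fraction_mul_of_le {τ S : ℝ} (hθ : 0 < θ) (hθ' : θ ≤ 1 / 4) (hτ : 0 < τ)
    (hS : 3 / θ ^ 2 * τ ≤ S) :
    τ ≤ θ * S ∧ τ ≤ (1 - θ) / 2 * S ∧ τ ≤ (1 - θ) * S := by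
  have hS₀ : 0 < S := (by positivity : 0 < 3 / θ ^ 2 * τ).trans_le hS
  rw [div_mul_eq_mul_div, div_le_iff₀ (by positivity)] at hS
  have h₁ : θ * S ≤ 1 / 4 * S := mul_le_mul_of_nonneg_right hθ' hS₀.le
  have h₂ : S * θ ^ 2 ≤ θ * S := by nlinarith [mul_pos hθ hS₀]
  exact ⟨by linarith, by linarith, by linarith⟩

end Cubic

namespace IsApproxCubicCost

variable {c₀ C ε τ : ℝ} {c : ℕ → ℝ} {f : ℕ → ℝ → ℝ → ℝ}

lemma le (hf : IsApproxCubicCost c₀ C ε τ c f) (k : ℕ) {x y : ℝ} (h : τ ≤ y - x) :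
    f k x y ≤ (c k + ε) * (y - x) ^ 3 := by
  linarith [(abs_le.mp (hf.abs_sub_le k x y h)).2]

lemma ge (hf : IsApproxCubicCost c₀ C ε τ c f) (k : ℕ) {x y : ℝ} (h : τ ≤ y - x) :
    (c k - ε) * (y - x) ^ 3 ≤ f k x y := by
  linarith [(abs_le.mp (hf.abs_sub_le k x y h)).1]

lemma nonneg (hf : IsApproxCubicCost c₀ C ε τ c f) (hε : ε ≤ c₀) (hτ : 0 ≤ τ) (k : ℕ) {x y : ℝ}
    (h : τ ≤ y - x) : 0 ≤ f k x y :=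
  (mul_nonneg (by linarith [(hf.coeff_mem k).1]) (pow_nonneg (by linarith) 3)).trans (hf.ge k h)

end IsApproxCubicCost

namespace IsMinSubdivision

variable {C θ τ a b P μ : ℝ} {c : ℕ → ℝ} {f : ℕ → ℝ → ℝ → ℝ} {n k : ℕ} {t : ℕ → ℝ}

lemma gap_succ_le (h : IsMinSubdivision f μ τ a b n t)
    (hf : IsApproxCubicCost (4 * C * θ) C (C * θ ^ 2 / 4) τ c f) (hC : 0 < C) (hθ : 0 < θ)
    (hθ' : θ ≤ 1 / 4) (hτ : 0 < τ) (hk : k + 1 < n) :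
    t (k + 2) - t (k + 1) ≤ 3 / θ ^ 2 * (t (k + 1) - t k) := by
  by_contra! hlt
  have g₀ := h.gap k (by omega)
  have g₁ : τ ≤ t (k + 2) - t (k + 1) := h.gap (k + 1) hk
  obtain ⟨x, hx⟩ : ∃ x, x = t (k + 1) - t k := ⟨_, rfl⟩
  obtain ⟨y, hy⟩ : ∃ y, y = t (k + 2) - t (k + 1) := ⟨_, rfl⟩
  rw [← hx, ← hy] at hlt
  have hS : 3 / θ ^ 2 * τ ≤ x + y := by
    have : 3 / θ ^ 2 * τ ≤ 3 / θ ^ 2 * x := by rw [hx]; gcongr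
    linarith [hτ.trans_le g₀]
  obtain ⟨h₁, -, h₂⟩ := le_fraction_mul_of_le hθ hθ' hτ hS
  have e₁ : t k + θ * (x + y) - t k = θ * (x + y) := by ring
  have e₂ : t (k + 2) - (t k + θ * (x + y)) = (1 - θ) * (x + y) := by rw [hx, hy]; ring
  have hmove := h.le_move hf.periodic hk (h₁.trans_eq e₁.symm) (h₂.trans_eq e₂.symm)
  have u₁ := hf.le k (h₁.trans_eq e₁.symm)
  have u₂ := hf.le (k + 1) (h₂.trans_eq e₂.symm)
  have l₁ := hf.nonneg (by nlinarith [mul_pos hC hθ]) hτ.le k g₀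
  have l₂ := hf.ge (k + 1) g₁
  rw [e₁] at u₁
  rw [e₂] at u₂
  rw [← hy] at l₂
  have := cubic_rebalance_lt hC hθ hθ' (hf.coeff_mem k).2 (hf.coeff_mem (k + 1))
    (hx ▸ hτ.trans_le g₀) hlt
  linarith

lemma gap_le_succ (h : IsMinSubdivision f μ τ a b n t)
    (hf : IsApproxCubicCost (4 * C * θ) C (C * θ ^ 2 / 4) τ c f) (hC : 0 < C) (hθ : 0 < θ)
    (hθ' : θ ≤ 1 / 4) (hτ : 0 < τ) (hk : k + 1 < n) :
    t (k + 1) - t k ≤ 3 / θ ^ 2 * (t (k + 2) - t (k + 1)) := by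
  by_contra! hlt
  have g₀ := h.gap k (by omega)
  have g₁ : τ ≤ t (k + 2) - t (k + 1) := h.gap (k + 1) hk
  obtain ⟨x, hx⟩ : ∃ x, x = t (k + 1) - t k := ⟨_, rfl⟩
  obtain ⟨y, hy⟩ : ∃ y, y = t (k + 2) - t (k + 1) := ⟨_, rfl⟩
  rw [← hx, ← hy] at hlt
  have hS : 3 / θ ^ 2 * τ ≤ y + x := by
    have : 3 / θ ^ 2 * τ ≤ 3 / θ ^ 2 * y := by rw [hy]; gcongr
    linarith [hτ.trans_le g₁]
  obtain ⟨h₁, -, h₂⟩ := le_fraction_mul_of_le hθ hθ' hτ hS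
  have e₁ : t (k + 2) - θ * (y + x) - t k = (1 - θ) * (y + x) := by rw [hx, hy]; ring
  have e₂ : t (k + 2) - (t (k + 2) - θ * (y + x)) = θ * (y + x) := by ring
  have hmove := h.le_move hf.periodic hk (h₂.trans_eq e₁.symm) (h₁.trans_eq e₂.symm)
  have u₁ := hf.le k (h₂.trans_eq e₁.symm)
  have u₂ := hf.le (k + 1) (h₁.trans_eq e₂.symm)
  have l₁ := hf.ge k g₀
  have l₂ := hf.nonneg (by nlinarith [mul_pos hC hθ]) hτ.le (k + 1) g₁
  rw [e₁] at u₁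
  rw [e₂] at u₂
  rw [← hx] at l₁
  have := cubic_rebalance_lt hC hθ hθ' (hf.coeff_mem (k + 1)).2 (hf.coeff_mem k)
    (hy ▸ hτ.trans_le g₁) hlt
  linarith

/-- Otherwise cutting the gap into three would save more than the price of two gaps. -/
lemma gap_le (h : IsMinSubdivision f (C * (P * τ) ^ 3) τ a b n t)
    (hf : IsApproxCubicCost (4 * C * θ) C (C * θ ^ 2 / 4) τ c f) (hC : 0 < C) (hθ : 0 < θ)
    (hθ' : θ ≤ 1 / 4) (hτ : 0 < τ) (hP : 3 / θ ^ 2 ≤ P) (hk : k < n) :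
    t (k + 1) - t k ≤ P / θ * τ := by
  by_contra! hlt
  have hP₀ : 0 < P := (by positivity : 0 < 3 / θ ^ 2).trans_le hP
  obtain ⟨D, hD⟩ : ∃ D, D = t (k + 1) - t k := ⟨_, rfl⟩
  rw [← hD] at hlt
  have hD₀ : 0 < D := hD ▸ hτ.trans_le (h.gap k hk)
  have hPD : P * τ < θ * D := by
    rwa [div_mul_eq_mul_div, div_lt_iff₀ hθ, mul_comm D] at hlt
  have hPDD : P * τ ≤ D := by nlinarith
  obtain ⟨h₂, h₁, -⟩ := le_fraction_mul_of_le hθ hθ' hτ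
    ((mul_le_mul_of_nonneg_right hP hτ.le).trans hPDD)
  obtain ⟨x, hx⟩ : ∃ x, x = t k + (1 - θ) / 2 * D := ⟨_, rfl⟩
  obtain ⟨y, hy⟩ : ∃ y, y = t (k + 1) - (1 - θ) / 2 * D := ⟨_, rfl⟩
  have e₁ : x - t k = (1 - θ) / 2 * D := by rw [hx]; ring
  have e₂ : y - x = θ * D := by rw [hx, hy, hD]; ring
  have e₃ : t (k + 1) - y = (1 - θ) / 2 * D := by rw [hy]; ring
  have hins := h.le_insert hf.periodic hk (h₁.trans_eq e₁.symm) (h₂.trans_eq e₂.symm)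
    (h₁.trans_eq e₃.symm)
  have u₁ := hf.le k (h₁.trans_eq e₁.symm)
  have u₂ := hf.le (k + 1) (h₂.trans_eq e₂.symm)
  have u₃ := hf.le k (h₁.trans_eq e₃.symm)
  have l := hf.ge k (h.gap k hk)
  rw [e₁] at u₁
  rw [e₂] at u₂
  rw [e₃] at u₃
  rw [← hD] at l
  have hsplit := cubic_split_le hC hθ hθ' (hf.coeff_mem k).1 (hf.coeff_mem (k + 1)).2 hD₀.le
  have hprice : C * (P * τ) ^ 3 < C * (θ * D) ^ 3 := by gcongr
  have : C * (θ * D) ^ 3 ≤ C * (θ * D ^ 3) := by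
    rw [mul_pow]
    gcongr
    exact pow_le_of_le_one hθ.le (by linarith) (by norm_num)
  linarith

/-- Otherwise merging the three gaps would cost less than the price of two gaps. -/
lemma le_triple_gap (h : IsMinSubdivision f (C * (P * τ) ^ 3) τ a b n t)
    (hf : IsApproxCubicCost (4 * C * θ) C (C * θ ^ 2 / 4) τ c f) (hC : 0 < C) (hθ : 0 < θ)
    (hθ' : θ ≤ 1 / 4) (hτ : 0 < τ) (hk : k + 2 < n) : P * τ ≤ t (k + 3) - t k := by
  have g₀ := h.gap k (by omega)
  have g₁ : τ ≤ t (k + 2) - t (k + 1) := h.gap (k + 1) (by omega)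
  have g₂ : τ ≤ t (k + 3) - t (k + 2) := h.gap (k + 2) hk
  have g : τ ≤ t (k + 3) - t k := by linarith
  have hε : C * θ ^ 2 / 4 ≤ 4 * C * θ := by nlinarith [mul_pos hC hθ]
  have hnn := hf.nonneg hε hτ.le
  have hrem := h.remove_le hf.periodic hk g
  have hQ : 0 ≤ t (k + 3) - t k := hτ.le.trans g
  have hup : f k (t k) (t (k + 3)) ≤ 2 * C * (t (k + 3) - t k) ^ 3 :=
    (hf.le k g).trans <| by
      gcongr
      nlinarith [(hf.coeff_mem k).2]
  refine le_of_pow_le_pow_left₀ three_ne_zero hQ (le_of_mul_le_mul_left ?_ hC)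
  linarith [hnn k g₀, hnn (k + 1) g₁, hnn k g₂]

lemma three_le_length (h : IsMinSubdivision f (C * (P * τ) ^ 3) τ a b n t)
    (hf : IsApproxCubicCost (4 * C * θ) C (C * θ ^ 2 / 4) τ c f) (hC : 0 < C) (hθ : 0 < θ)
    (hθ' : θ ≤ 1 / 4) (hτ : 0 < τ) (hP : 3 / θ ^ 2 ≤ P) (hab : 3 * (P / θ) * τ < b - a) :
    3 ≤ n := by
  by_contra! hlt
  have hP₀ : 0 < P := (by positivity : 0 < 3 / θ ^ 2).trans_le hP
  have hn : (n : ℝ) ≤ 2 := by exact_mod_cast Nat.lt_succ_iff.mp hlt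
  have hle := h.le_mul_of_gap_le fun k hk => h.gap_le hf hC hθ hθ' hτ hP hk
  have hpos : 0 < P / θ * τ := by positivity
  nlinarith

/-- Each gap belongs to a triple of consecutive gaps, which is long and whose members are
comparable. -/
lemma lt_gap (h : IsMinSubdivision f (C * (4 * (3 / θ ^ 2) ^ 2 * τ) ^ 3) τ a b n t)
    (hf : IsApproxCubicCost (4 * C * θ) C (C * θ ^ 2 / 4) τ c f) (hC : 0 < C) (hθ : 0 < θ)
    (hθ' : θ ≤ 1 / 4) (hτ : 0 < τ) (hn : 3 ≤ n) (hk : k < n) : τ < t (k + 1) - t k := by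
  have hr : ∀ j, j + 1 < n → t (j + 2) - t (j + 1) ≤ 3 / θ ^ 2 * (t (j + 1) - t j) := fun j hj =>
    h.gap_succ_le hf hC hθ hθ' hτ hj
  have hl : ∀ j, j + 1 < n → t (j + 1) - t j ≤ 3 / θ ^ 2 * (t (j + 2) - t (j + 1)) := fun j hj =>
    h.gap_le_succ hf hC hθ hθ' hτ hj
  have htriple : ∀ j, j + 2 < n → 4 * (3 / θ ^ 2) ^ 2 * τ ≤ t (j + 3) - t j := fun j hj =>
    h.le_triple_gap hf hC hθ hθ' hτ hj
  have hB : 1 ≤ 3 / θ ^ 2 := by rw [le_div_iff₀ (by positivity)]; nlinarith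
  generalize 3 / θ ^ 2 = B at hr hl htriple hB
  have hpos : 0 < t (k + 1) - t k := hτ.trans_le (h.gap k hk)
  generalize hD : t (k + 1) - t k = D at hpos ⊢
  have hB₁ : B * D ≤ B ^ 2 * D := by nlinarith [mul_pos (one_pos.trans_le hB) hpos]
  have hB₀ : D ≤ B ^ 2 * D := (le_mul_of_one_le_left hpos.le hB).trans hB₁
  have hB₂ : ∀ {x y}, x ≤ B * y → y ≤ B * D → x ≤ B ^ 2 * D := fun hx hy => by
    nlinarith [mul_le_mul_of_nonneg_left hy (zero_le_one.trans hB)]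
  have key : ∀ j, j + 2 < n → t (j + 1) - t j ≤ B ^ 2 * D → t (j + 2) - t (j + 1) ≤ B ^ 2 * D →
      t (j + 3) - t (j + 2) ≤ B ^ 2 * D → τ < D := fun j hj h₁ h₂ h₃ => by
    have : B ^ 2 * (4 * τ) ≤ B ^ 2 * (3 * D) := by linarith [htriple j hj]
    linarith [le_of_mul_le_mul_left this (by positivity)]
  rcases Nat.lt_or_ge (k + 2) n with hk₂ | hk₂
  · have a₁ := hD ▸ hr k (by omega)
    exact key k hk₂ (hD ▸ hB₀) (a₁.trans hB₁) (hB₂ (hr (k + 1) hk₂) a₁)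
  · obtain ⟨j, rfl⟩ : ∃ j, k = j + 1 := ⟨k - 1, by omega⟩
    have a₁ := hD ▸ hl j (by omega)
    rcases Nat.lt_or_ge (j + 2) n with hj₂ | hj₂
    · exact key j hj₂ (a₁.trans hB₁) (hD ▸ hB₀) ((hD ▸ hr (j + 1) hj₂).trans hB₁)
    · obtain ⟨i, rfl⟩ : ∃ i, j = i + 1 := ⟨j - 1, by omega⟩
      exact key i (by omega) (hB₂ (hl i (by omega)) a₁) (a₁.trans hB₁) (hD ▸ hB₀)

end IsMinSubdivision

/-- Minimise the total cost, with a price for each gap chosen so that neither very long nor very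
short gaps are economical: the gaps of the minimiser stay off the constraint `τ`, and its points are
critical. -/
theorem exists_critical_subdivision {c₀ C : ℝ} (hc₀ : 0 < c₀) (hC : c₀ ≤ C) :
    ∃ ε > 0, ∃ Λ > 0, ∀ c f τ, 0 < τ → IsApproxCubicCost c₀ C ε τ c f →
      ∀ a b, Λ * τ < b - a → ∃ (n : ℕ) (t : ℕ → ℝ), t 0 = a ∧ t n = b ∧
        (∀ k < n, t (k + 1) - t k ∈ Ioc τ (Λ * τ)) ∧
        ∀ k, k + 1 < n →
          IsLocalMin (fun s => f k (t k) s + f (k + 1) s (t (k + 2))) (t (k + 1)) := by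
  have hC₀ : 0 < C := hc₀.trans_le hC
  obtain ⟨θ, hθ, hθ', rfl⟩ : ∃ θ, 0 < θ ∧ θ ≤ 1 / 4 ∧ c₀ = 4 * C * θ :=
    ⟨c₀ / (4 * C), by positivity, by rw [div_le_iff₀ (by positivity)]; linarith, by field_simp⟩
  set P : ℝ := 4 * (3 / θ ^ 2) ^ 2
  have hB : 1 ≤ 3 / θ ^ 2 := by rw [le_div_iff₀ (by positivity)]; nlinarith
  have hP : 3 / θ ^ 2 ≤ P := by nlinarith
  have hPθ : 1 ≤ P / θ := by rw [le_div_iff₀ hθ]; linarith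
  refine ⟨C * θ ^ 2 / 4, by positivity, 3 * (P / θ), by positivity, ?_⟩
  intro c f τ hτ hf a b hab
  obtain ⟨n, t, ht⟩ := exists_isMinSubdivision hτ hf.continuousOn (C * (P * τ) ^ 3)
    (by nlinarith : τ ≤ b - a)
  have hn := ht.three_le_length hf hC₀ hθ hθ' hτ hP hab
  have hlt := fun k (hk : k < n) => ht.lt_gap hf hC₀ hθ hθ' hτ hn hk
  have hle := fun k (hk : k < n) => ht.gap_le hf hC₀ hθ hθ' hτ hP hk
  refine ⟨n, t, ht.left, ht.right, fun k hk => ⟨hlt k hk, by nlinarith [hle k hk]⟩, fun k hk => ?_⟩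
  have g₀ := hlt k (by omega)
  have g₁ : τ < t (k + 2) - t (k + 1) := hlt (k + 1) hk
  filter_upwards [Ioo_mem_nhds (by linarith : t k + τ < t (k + 1))
    (by linarith : t (k + 1) < t (k + 2) - τ)] with s hs
  exact ht.le_move hf.periodic hk (by linarith [hs.1]) (by linarith [hs.2])

section GlobalIntegralCurve

variable {E : Type*} [NormedAddCommGroup E] [NormedSpace ℝ E] {v : ℝ → E → E} {K : NNReal}

theorem exists_hasDerivWithinAt_Icc_of_norm_le [CompleteSpace E] {C R : ℝ}
    (hv : ∀ t, LipschitzWith K (v t)) (hc : ∀ x, Continuous fun t => v t x)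
    (hC : ∀ t x, ‖v t x‖ ≤ C) (hR : 0 < R) (t₀ : ℝ) (x : E) :
    ∃ z : ℝ → E, z t₀ = x ∧ ∀ t ∈ Icc (t₀ - R) (t₀ + R),
      HasDerivWithinAt z (v t (z t)) (Icc (t₀ - R) (t₀ + R)) t := by
  have hmem : t₀ ∈ Icc (t₀ - R) (t₀ + R) := ⟨by linarith, by linarith⟩
  have hPL : IsPicardLindelof v (⟨t₀, hmem⟩ : Icc (t₀ - R) (t₀ + R)) x
      (C.toNNReal * R.toNNReal) 0 C.toNNReal K :=
    { lipschitzOnWith := fun t _ => (hv t).lipschitzOnWith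
      continuousOn := fun y _ => (hc y).continuousOn
      norm_le := fun t _ y _ => (hC t y).trans (Real.le_coe_toNNReal C)
      mul_max_le := by simp [hR.le] }
  exact hPL.exists_eq_forall_mem_Icc_hasDerivWithinAt₀

theorem exists_hasDerivAt_of_forall_Ioo (hv : ∀ t, LipschitzWith K (v t)) {t₀ : ℝ} {x : E}
    (h : ∀ R, 0 < R → ∃ z : ℝ → E, z t₀ = x ∧
      ∀ t ∈ Ioo (t₀ - R) (t₀ + R), HasDerivAt z (v t (z t)) t) :
    ∃ z : ℝ → E, z t₀ = x ∧ ∀ t, HasDerivAt z (v t (z t)) t := by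
  choose! Z hZ₀ hZ using h
  have hagree {R R' : ℝ} (hR : 0 < R) (hRR' : R ≤ R') :
      EqOn (Z R) (Z R') (Ioo (t₀ - R) (t₀ + R)) :=
    ODE_solution_unique_of_mem_Ioo (v := v) (s := fun _ => univ) (K := K)
      (fun t _ => (hv t).lipschitzOnWith) (t₀ := t₀) ⟨by linarith, by linarith⟩
      (fun t ht => ⟨hZ R hR t ht, mem_univ _⟩)
      (fun t ht => ⟨hZ R' (hR.trans_le hRR') t (Ioo_subset_Ioo (by linarith) (by linarith) ht),
        mem_univ _⟩)
      ((hZ₀ R hR).trans (hZ₀ R' (hR.trans_le hRR')).symm)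
  refine ⟨fun t => Z (|t - t₀| + 1) t, by simp [hZ₀], fun t => ?_⟩
  have hloc : (fun s => Z (|s - t₀| + 1) s) =ᶠ[𝓝 t] Z (|t - t₀| + 2) := by
    filter_upwards [Metric.ball_mem_nhds t one_pos] with s hs
    have hst : |s - t₀| ≤ 1 + |t - t₀| :=
      (abs_sub_le s t t₀).trans (by gcongr; exact (Metric.mem_ball.mp hs).le)
    exact hagree (by positivity) (by linarith)
      ⟨by linarith [neg_abs_le (s - t₀)], by linarith [le_abs_self (s - t₀)]⟩
  have hderiv := (hZ _ (by positivity) t ⟨by linarith [neg_abs_le (t - t₀)],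
    by linarith [le_abs_self (t - t₀)]⟩).congr_of_eventuallyEq hloc
  rwa [← hloc.eq_of_nhds] at hderiv

end GlobalIntegralCurve

/-- `u`, with derivative `u'`, solves `ü = F(t, u)` on the whole line. The derivative is carried
along explicitly, so that statements about `u` and `u'` need no `deriv`. -/
def IsSecondOrderSol (F : ℝ → ℝ → ℝ) (u u' : ℝ → ℝ) : Prop :=
  ∀ t, HasDerivAt u (u' t) t ∧ HasDerivAt u' (F t (u t)) t

namespace IsSecondOrderSol

/-- The vector field on the phase plane of the first-order system equivalent to `ü = F(t, u)`. -/
def field (F : ℝ → ℝ → ℝ) (t : ℝ) (z : ℝ × ℝ) : ℝ × ℝ := (z.2, F t z.1)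

variable {F G : ℝ → ℝ → ℝ} {u u' w w' : ℝ → ℝ} {K : NNReal}

lemma lipschitzWith_prodMk_field (hF : ∀ t, LipschitzWith K (F t)) {φ : ℝ → ℝ}
    (hφ : LipschitzWith 1 φ) (t : ℝ) :
    LipschitzWith (max 1 K) fun z : ℝ × ℝ => (φ z.2, F t z.1) := by
  have h₁ : LipschitzWith 1 fun z : ℝ × ℝ => φ z.2 := by
    simpa [Function.comp_def] using hφ.comp LipschitzWith.prod_snd
  have h₂ : LipschitzWith K fun z : ℝ × ℝ => F t z.1 := by
    simpa [Function.comp_def] using (hF t).comp LipschitzWith.prod_fst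
  exact h₁.prodMk h₂

lemma lipschitzWith_field (hF : ∀ t, LipschitzWith K (F t)) (t : ℝ) :
    LipschitzWith (max 1 K) (field F t) :=
  lipschitzWith_prodMk_field hF LipschitzWith.id t

/-- The velocity is truncated at `|y| + C R`, which no solution reaches within time `R`; this makes
the vector field bounded. -/
lemma exists_hasDerivAt_field_Ioo {C R : ℝ} (hF : ∀ t, LipschitzWith K (F t))
    (hc : ∀ x, Continuous fun t => F t x) (hC : ∀ t x, |F t x| ≤ C) (hR : 0 < R) (t₀ x y : ℝ) :
    ∃ z : ℝ → ℝ × ℝ, z t₀ = (x, y) ∧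
      ∀ t ∈ Ioo (t₀ - R) (t₀ + R), HasDerivAt z (field F t (z t)) t := by
  have hC₀ : 0 ≤ C := (abs_nonneg _).trans (hC 0 0)
  obtain ⟨M, hM⟩ : ∃ M, M = |y| + C * R := ⟨_, rfl⟩
  have hM₀ : 0 ≤ M := hM ▸ by positivity
  have hbd (t : ℝ) (z : ℝ × ℝ) : ‖(max (-M) (min z.2 M), F t z.1)‖ ≤ max M C :=
    norm_prod_le_iff.mpr
      ⟨le_max_of_le_left (abs_le.mpr ⟨le_max_left _ _, max_le (by linarith) (min_le_right _ _)⟩),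
        le_max_of_le_right (hC _ _)⟩
  obtain ⟨z, hz₀, hz⟩ := exists_hasDerivWithinAt_Icc_of_norm_le
    (lipschitzWith_prodMk_field hF ((LipschitzWith.id.min_const M).const_max (-M)))
    (fun z => continuous_const.prodMk (hc _)) hbd hR t₀ (x, y)
  refine ⟨z, hz₀, fun t ht => ?_⟩
  have ht' := Ioo_subset_Icc_self ht
  have hspeed : |(z t).2 - y| ≤ C * |t - t₀| := by
    have := (convex_Icc (t₀ - R) (t₀ + R)).norm_image_sub_le_of_norm_hasDerivWithin_le
      (fun s hs => (hasFDerivAt_snd (𝕜 := ℝ) (p := z s)).comp_hasDerivWithinAt s (hz s hs))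
      (fun s _ => hC s _) (x := t₀) ⟨by linarith, by linarith⟩ ht'
    simpa [hz₀] using this
  have hle : |(z t).2| ≤ M := by
    have hR' : |t - t₀| ≤ R := abs_le.mpr ⟨by linarith [ht.1], by linarith [ht.2]⟩
    linarith [abs_sub_abs_le_abs_sub (z t).2 y, mul_le_mul_of_nonneg_left hR' hC₀]
  have hderiv := (hz t ht').hasDerivAt (Icc_mem_nhds ht.1 ht.2)
  simp only [id_eq] at hderiv
  rwa [min_eq_left (abs_le.mp hle).2, max_eq_right (abs_le.mp hle).1] at hderiv

theorem exists_of_bounded {C : ℝ} (hF : ∀ t, LipschitzWith K (F t))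
    (hc : ∀ x, Continuous fun t => F t x) (hC : ∀ t x, |F t x| ≤ C) (t₀ x y : ℝ) :
    ∃ u u' : ℝ → ℝ, IsSecondOrderSol F u u' ∧ u t₀ = x ∧ u' t₀ = y := by
  obtain ⟨z, hz₀, hz⟩ := exists_hasDerivAt_of_forall_Ioo (lipschitzWith_field hF)
    fun R hR => exists_hasDerivAt_field_Ioo hF hc hC hR t₀ x y
  exact ⟨fun t => (z t).1, fun t => (z t).2,
    fun t => ⟨(hasFDerivAt_fst (𝕜 := ℝ) (p := z t)).comp_hasDerivAt t (hz t),
      (hasFDerivAt_snd (𝕜 := ℝ) (p := z t)).comp_hasDerivAt t (hz t)⟩, by simp [hz₀], by simp [hz₀]⟩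

lemma hasDerivAt_prodMk (h : IsSecondOrderSol F u u') (t : ℝ) :
    HasDerivAt (fun t => (u t, u' t)) (field F t (u t, u' t)) t :=
  (h t).1.prodMk (h t).2

lemma continuous_prodMk (h : IsSecondOrderSol F u u') : Continuous fun t => (u t, u' t) :=
  continuous_iff_continuousAt.mpr fun t => (h.hasDerivAt_prodMk t).continuousAt

lemma continuous (h : IsSecondOrderSol F u u') : Continuous u :=
  h.continuous_prodMk.fst

lemma continuous_deriv (h : IsSecondOrderSol F u u') : Continuous u' :=
  h.continuous_prodMk.snd

lemma comp_neg (h : IsSecondOrderSol F u u') :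
    IsSecondOrderSol (fun t x => F (-t) x) (fun t => u (-t)) (fun t => -u' (-t)) := fun t => by
  constructor
  · simpa [Function.comp_def] using (h (-t)).1.comp t (hasDerivAt_neg t)
  · simpa [Function.comp_def] using ((h (-t)).2.comp t (hasDerivAt_neg t)).fun_neg

lemma abs_sub_le_of_le (hF : ∀ t, LipschitzWith K (F t)) (hu : IsSecondOrderSol F u u')
    (hw : IsSecondOrderSol F w w') {t₀ t δ : ℝ} (ht : t₀ ≤ t) (h₀ : |u t₀ - w t₀| ≤ δ)
    (h₁ : |u' t₀ - w' t₀| ≤ δ) :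
    |u t - w t| ≤ δ * Real.exp (max 1 K * (t - t₀)) ∧
      |u' t - w' t| ≤ δ * Real.exp (max 1 K * (t - t₀)) := by
  have := dist_le_of_trajectories_ODE (lipschitzWith_field hF)
    hu.continuous_prodMk.continuousOn (fun s _ => (hu.hasDerivAt_prodMk s).hasDerivWithinAt)
    hw.continuous_prodMk.continuousOn (fun s _ => (hw.hasDerivAt_prodMk s).hasDerivWithinAt)
    (max_le h₀ h₁) t ⟨ht, le_rfl⟩
  simpa [Prod.dist_eq, Real.dist_eq] using this

theorem abs_sub_le (hF : ∀ t, LipschitzWith K (F t)) (hu : IsSecondOrderSol F u u')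
    (hw : IsSecondOrderSol F w w') {t₀ δ : ℝ} (h₀ : |u t₀ - w t₀| ≤ δ)
    (h₁ : |u' t₀ - w' t₀| ≤ δ) (t : ℝ) :
    |u t - w t| ≤ δ * Real.exp (max 1 K * |t - t₀|) ∧
      |u' t - w' t| ≤ δ * Real.exp (max 1 K * |t - t₀|) := by
  rcases le_total t₀ t with ht | ht
  · rw [abs_of_nonneg (sub_nonneg.mpr ht)]
    exact abs_sub_le_of_le hF hu hw ht h₀ h₁
  · have := abs_sub_le_of_le (fun t => hF (-t)) hu.comp_neg hw.comp_neg (neg_le_neg ht)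
      (by simpa using h₀) (by rwa [neg_neg, neg_sub_neg, abs_sub_comm])
    simpa only [neg_neg, neg_sub_neg, abs_sub_comm (w' t), abs_of_nonpos (sub_nonpos.mpr ht),
      neg_sub] using this

theorem eq_of_eq_of_eq (hF : ∀ t, LipschitzWith K (F t)) (hu : IsSecondOrderSol F u u')
    (hw : IsSecondOrderSol F w w') {t₀ : ℝ} (h₀ : u t₀ = w t₀) (h₁ : u' t₀ = w' t₀) :
    u = w ∧ u' = w' := by
  have h (t : ℝ) := abs_sub_le hF hu hw (t₀ := t₀) (δ := 0) (by simp [h₀]) (by simp [h₁]) t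
  simp only [zero_mul, abs_nonpos_iff, sub_eq_zero] at h
  exact ⟨funext fun t => (h t).1, funext fun t => (h t).2⟩

theorem eqOn_Icc_of_eqOn_rhs (hG : ∀ t, LipschitzWith K (G t)) (hu : IsSecondOrderSol F u u')
    (hw : IsSecondOrderSol G w w') {a b : ℝ} (h₀ : u a = w a) (h₁ : u' a = w' a)
    (hFG : ∀ t ∈ Icc a b, F t (u t) = G t (u t)) :
    ∀ t ∈ Icc a b, u t = w t ∧ u' t = w' t := by
  have hu' (s : ℝ) (hs : s ∈ Ico a b) :
      HasDerivWithinAt (fun t => (u t, u' t)) (field G s (u s, u' s)) (Ici s) s := by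
    have := (hu.hasDerivAt_prodMk s).hasDerivWithinAt (s := Ici s)
    rwa [field, hFG s (Ico_subset_Icc_self hs)] at this
  have := ODE_solution_unique (lipschitzWith_field hG) hu.continuous_prodMk.continuousOn hu'
    hw.continuous_prodMk.continuousOn (fun s _ => (hw.hasDerivAt_prodMk s).hasDerivWithinAt)
    (by simp [h₀, h₁])
  simpa [EqOn] using this

end IsSecondOrderSol

/-- The right-hand side of `ü = p(t) - g(u)`, that is, of the equation `ü + g(u) = p(t)`. -/
abbrev force (g p : ℝ → ℝ) (t x : ℝ) : ℝ := p t - g x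

/-- A solution of `ü = F(t, u)` vanishing at `a` and `b` whose derivative is, on `[a, b]`, within
`η (b - a)` of the derivative of the parabola `α (s - a) (b - s) / 2`. -/
structure IsArc (F : ℝ → ℝ → ℝ) (α η a b : ℝ) (u u' : ℝ → ℝ) : Prop where
  sol : IsSecondOrderSol F u u'
  left : u a = 0
  right : u b = 0
  deriv_le : ∀ s ∈ Icc a b, |u' s - α * ((a + b) / 2 - s)| ≤ η * (b - a)

section Parabola

variable {F : ℝ → ℝ → ℝ} {u u' : ℝ → ℝ} {α η a b s : ℝ}

lemma half_mul_min_le_mul (hs : s ∈ Icc a b) :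
    (b - a) / 2 * min (s - a) (b - s) ≤ (s - a) * (b - s) := by
  obtain ⟨h₁, h₂⟩ := hs
  rcases le_total (s - a) (b - s) with h | h
  · rw [min_eq_left h]; nlinarith
  · rw [min_eq_right h]; nlinarith

lemma IsArc.abs_sub_parabola_le (h : IsArc F α η a b u u') (hs : s ∈ Icc a b) :
    |u s - α / 2 * ((s - a) * (b - s))| ≤ η * (b - a) * min (s - a) (b - s) := by
  have hd (t : ℝ) : HasDerivAt (fun t => u t - α / 2 * ((t - a) * (b - t)))
      (u' t - α * ((a + b) / 2 - t)) t := by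
    refine ((h.sol t).1.sub ((((hasDerivAt_id t).sub_const a).mul
      ((hasDerivAt_const t b).sub (hasDerivAt_id t))).const_mul (α / 2))).congr_deriv ?_
    simp only [id_eq, Pi.sub_apply]
    ring
  have hab : a ≤ b := hs.1.trans hs.2
  have hle (x : ℝ) (hx : x ∈ Icc a b) :=
    (convex_Icc a b).norm_image_sub_le_of_norm_hasDerivWithin_le
      (fun t _ => (hd t).hasDerivWithinAt) h.deriv_le hx hs
  simp only [Real.norm_eq_abs] at hle
  have hleft := hle a ⟨le_rfl, hab⟩
  have hright := hle b ⟨hab, le_rfl⟩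
  rw [h.left, abs_of_nonneg (sub_nonneg.mpr hs.1)] at hleft
  rw [h.right, abs_of_nonpos (sub_nonpos.mpr hs.2), neg_sub] at hright
  rcases min_choice (s - a) (b - s) with hmin | hmin <;> rw [hmin]
  · simpa using hleft
  · simpa using hright

lemma IsArc.lower (h : IsArc F α η a b u u') (hα : 0 < α) (hη : η ≤ α / 8) (hs : s ∈ Icc a b) :
    α / 8 * (b - a) * min (s - a) (b - s) ≤ u s := by
  have hlow := (abs_le.mp (h.abs_sub_parabola_le hs)).1
  have hmin : 0 ≤ min (s - a) (b - s) := le_min (sub_nonneg.mpr hs.1) (sub_nonneg.mpr hs.2)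
  have hab : 0 ≤ b - a := by linarith [hs.1, hs.2]
  have herr : η * (b - a) * min (s - a) (b - s) ≤ α / 8 * (b - a) * min (s - a) (b - s) := by
    gcongr
  have := mul_le_mul_of_nonneg_left (half_mul_min_le_mul hs) (by positivity : 0 ≤ α / 2)
  linarith

end Parabola

theorem IsSecondOrderSol.exists_isArc_of_abs_deriv_sub_le {F : ℝ → ℝ → ℝ} {K : NNReal}
    {C α δ a b : ℝ} (hF : ∀ t, LipschitzWith K (F t)) (hc : ∀ x, Continuous fun t => F t x)
    (hC : ∀ t x, |F t x| ≤ C) (hab : a < b)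
    (hδ : ∀ u u', IsSecondOrderSol F u u' → ∀ t ∈ Icc a b,
      |u' t - (u' a - α * (t - a))| ≤ δ * (b - a)) :
    ∃ u u', IsArc F α (2 * δ) a b u u' := by
  choose U U' hU hUa hU'a using fun v => IsSecondOrderSol.exists_of_bounded hF hc hC a 0 v
  have hvel (v t : ℝ) (ht : t ∈ Icc a b) : |U' v t - (v - α * (t - a))| ≤ δ * (b - a) := by
    simpa only [hU'a] using hδ _ _ (hU v) t ht
  have hend (v : ℝ) : |U v b - (v * (b - a) - α / 2 * (b - a) ^ 2)| ≤ δ * (b - a) * (b - a) := by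
    have hder (t : ℝ) : HasDerivAt (fun t => U v t - (v * (t - a) - α / 2 * (t - a) ^ 2))
        (U' v t - (v - α * (t - a))) t := by
      refine ((hU v t).1.sub ((((hasDerivAt_id t).sub_const a).const_mul v).sub
        ((((hasDerivAt_id t).sub_const a).pow 2).const_mul (α / 2)))).congr_deriv ?_
      norm_num
      ring
    have := (convex_Icc a b).norm_image_sub_le_of_norm_hasDerivWithin_le
      (fun t _ => (hder t).hasDerivWithinAt) (hvel v) (left_mem_Icc.mpr hab.le)
      (right_mem_Icc.mpr hab.le)
    simpa [Real.norm_eq_abs, hUa, abs_of_pos (sub_pos.mpr hab)] using this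
  have hcont : Continuous fun v => U v b :=
    (LipschitzWith.of_dist_le' (K := Real.exp (max 1 K * |b - a|)) fun v w => by
      rw [Real.dist_eq, Real.dist_eq, mul_comm]
      exact ((hU v).abs_sub_le hF (hU w) (t₀ := a) (by simp [hUa]) (by rw [hU'a, hU'a]) b).1
      ).continuous
  have hδ₀ : 0 ≤ δ * (b - a) := (abs_nonneg _).trans (hvel 0 a (left_mem_Icc.mpr hab.le))
  obtain ⟨v, hv, hv₀⟩ : (0 : ℝ) ∈ (fun v => U v b) ''
      Icc (α / 2 * (b - a) - δ * (b - a)) (α / 2 * (b - a) + δ * (b - a)) := by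
    refine intermediate_value_Icc (by linarith) hcont.continuousOn ⟨?_, ?_⟩
    · linarith [(abs_le.mp (hend (α / 2 * (b - a) - δ * (b - a)))).2]
    · linarith [(abs_le.mp (hend (α / 2 * (b - a) + δ * (b - a)))).1]
  refine ⟨U v, U' v, hU v, hUa v, hv₀, fun s hs => ?_⟩
  obtain ⟨hlo, hhi⟩ := abs_le.mp (hvel v s hs)
  exact abs_le.mpr ⟨by linarith [hv.1], by linarith [hv.2]⟩

/-- The normalised equation `ü + g(u) = p(t)`: `g`, with derivative `g'`, is increasing,
`K`-Lipschitz, concave on `[0, ∞)`, with limit `α > 0` at `+∞`, the continuous function `p` has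
asymptotic average `0`, and both are bounded by `M`. -/
structure IsNormalized (g g' p : ℝ → ℝ) (M α : ℝ) (K : NNReal) : Prop where
  hasDerivAt : ∀ x, HasDerivAt g (g' x) x
  mono : Monotone g
  lip : LipschitzWith K g
  bdd : ∀ x, |g x| ≤ M
  anti : AntitoneOn g' (Ici 0)
  deriv_pos : ∀ x, 0 ≤ x → 0 < g' x
  lim : Tendsto g atTop (𝓝 α)
  pos : 0 < α
  p_cont : Continuous p
  p_bdd : ∀ t, |p t| ≤ M
  avg : ∀ ε > 0, ∃ S > 0, ∀ t T, S ≤ T → |∫ s in t..t + T, p s| ≤ ε * T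

/-- The force `p(t) - g(u)` with `u` replaced by `max u ψ`, where the tent function
`ψ(t) = κ (b - a) min (t - a, b - t)` is a lower barrier for arcs on `[a, b]`. -/
def barrierForce (g p : ℝ → ℝ) (κ a b t x : ℝ) : ℝ :=
  p t - g (max x (κ * (b - a) * min (t - a) (b - t)))

namespace IsNormalized

variable {g g' p : ℝ → ℝ} {M α : ℝ} {K : NNReal}

lemma continuous (h : IsNormalized g g' p M α K) : Continuous g := h.lip.continuous

lemma le_lim (h : IsNormalized g g' p M α K) (x : ℝ) : g x ≤ α := h.mono.ge_of_tendsto h.lim x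

lemma lim_le (h : IsNormalized g g' p M α K) : α ≤ M :=
  le_of_tendsto' h.lim fun x => (abs_le.mp (h.bdd x)).2

lemma bound_pos (h : IsNormalized g g' p M α K) : 0 < M := h.pos.trans_le h.lim_le

lemma deficit_nonneg (h : IsNormalized g g' p M α K) (x : ℝ) : 0 ≤ α - g x :=
  sub_nonneg.mpr (h.le_lim x)

lemma deficit_le (h : IsNormalized g g' p M α K) (x : ℝ) : α - g x ≤ 2 * M := by
  linarith [h.lim_le, (abs_le.mp (h.bdd x)).1]

lemma exists_deficit_le (h : IsNormalized g g' p M α K) {ε : ℝ} (hε : 0 < ε) :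
    ∃ R > 0, ∀ x, R ≤ x → α - g x ≤ ε := by
  obtain ⟨R, hR⟩ := eventually_atTop.mp
    (h.lim.eventually (lt_mem_nhds (show α - ε < α by linarith)))
  exact ⟨max R 1, by positivity, fun x hx => by linarith [hR x (le_of_max_le_left hx)]⟩

lemma lipschitzWith_force (h : IsNormalized g g' p M α K) (t : ℝ) :
    LipschitzWith K (force g p t) := by
  simpa using (LipschitzWith.const (p t)).sub h.lip

lemma continuous_force (h : IsNormalized g g' p M α K) (x : ℝ) :
    Continuous fun t => force g p t x :=
  h.p_cont.sub continuous_const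

lemma abs_force_le (h : IsNormalized g g' p M α K) (t x : ℝ) : |force g p t x| ≤ 2 * M :=
  (abs_sub _ _).trans (by linarith [h.p_bdd t, h.bdd x])

lemma exists_sol (h : IsNormalized g g' p M α K) (t₀ x y : ℝ) :
    ∃ u u' : ℝ → ℝ, IsSecondOrderSol (force g p) u u' ∧ u t₀ = x ∧ u' t₀ = y :=
  IsSecondOrderSol.exists_of_bounded h.lipschitzWith_force h.continuous_force h.abs_force_le t₀ x y

lemma exists_integral_p_le (h : IsNormalized g g' p M α K) {ε : ℝ} (hε : 0 < ε) :
    ∃ τ > 0, ∀ T, τ ≤ T → ∀ s t, |t - s| ≤ T → |∫ x in s..t, p x| ≤ ε * T := by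
  obtain ⟨S, hS, hav⟩ := h.avg ε hε
  refine ⟨max S (M * S / ε), lt_max_of_lt_left hS, fun T hT s t hst => ?_⟩
  wlog hle : s ≤ t generalizing s t
  · rw [intervalIntegral.integral_symm, abs_neg]
    exact this t s (by rwa [abs_sub_comm]) (le_of_not_ge hle)
  rw [abs_of_nonneg (sub_nonneg.mpr hle)] at hst
  rcases le_total S (t - s) with hlong | hshort
  · calc |∫ x in s..t, p x| ≤ ε * (t - s) := by simpa using hav s (t - s) hlong
      _ ≤ ε * T := by gcongr
  · calc |∫ x in s..t, p x| ≤ M * |t - s| :=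
          (intervalIntegral.norm_integral_le_of_norm_le_const fun x _ => h.p_bdd x :
            ‖∫ x in s..t, p x‖ ≤ M * |t - s|)
      _ ≤ M * S := by
          rw [abs_of_nonneg (sub_nonneg.mpr hle)]
          exact mul_le_mul_of_nonneg_left hshort h.bound_pos.le
      _ ≤ ε * T := (div_le_iff₀' hε).mp ((le_max_right _ _).trans hT)

lemma exists_integral_deficit_le (h : IsNormalized g g' p M α K) {κ ε : ℝ} (hκ : 0 < κ)
    (hε : 0 < ε) :
    ∃ τ > 0, ∀ T, τ ≤ T → ∫ r in (0 : ℝ)..T, (α - g (κ * T * r)) ≤ ε * T := by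
  obtain ⟨R, _, hRg⟩ := h.exists_deficit_le (half_pos hε)
  refine ⟨max 1 (max (R / κ) (4 * M / ε)), by positivity, fun T hT => ?_⟩
  obtain ⟨h₁, hT'⟩ := max_le_iff.mp hT
  obtain ⟨h₂, h₃⟩ := max_le_iff.mp hT'
  rw [div_le_iff₀ hκ] at h₂
  rw [div_le_iff₀ hε] at h₃
  have hcont : Continuous fun r => α - g (κ * T * r) :=
    continuous_const.sub (h.continuous.comp (by fun_prop))
  have hint (x y : ℝ) := hcont.intervalIntegrable (μ := MeasureTheory.volume) x y
  have hnear : ∫ r in (0 : ℝ)..1, (α - g (κ * T * r)) ≤ ∫ r in (0 : ℝ)..1, 2 * M :=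
    intervalIntegral.integral_mono_on zero_le_one (hint _ _) (by simp) fun x _ => h.deficit_le _
  have hfar : ∫ r in (1 : ℝ)..T, (α - g (κ * T * r)) ≤ ∫ r in (1 : ℝ)..T, ε / 2 :=
    intervalIntegral.integral_mono_on h₁ (hint _ _) (by simp) fun x hx => hRg _ (by
      have : κ * T * 1 ≤ κ * T * x := mul_le_mul_of_nonneg_left hx.1 (by positivity)
      linarith)
  rw [← intervalIntegral.integral_add_adjacent_intervals (hint 0 1) (hint 1 T)]
  simp only [intervalIntegral.integral_const, smul_eq_mul] at hnear hfar
  linarith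

lemma exists_integral_max_deficit_le (h : IsNormalized g g' p M α K) {κ ε : ℝ} (hκ : 0 < κ)
    (hε : 0 < ε) :
    ∃ τ > 0, ∀ a b, τ ≤ b - a → ∀ v : ℝ → ℝ, Continuous v → ∀ t ∈ Icc a b,
      |∫ s in a..t, (α - g (max (v s) (κ * (b - a) * min (s - a) (b - s))))| ≤ ε * (b - a) := by
  obtain ⟨τ, hτ, hd⟩ := h.exists_integral_deficit_le hκ (half_pos hε)
  refine ⟨τ, hτ, fun a b hab v hv t ht => ?_⟩
  obtain ⟨c, hc⟩ : ∃ c, c = κ * (b - a) := ⟨_, rfl⟩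
  have hcont := h.continuous
  have hmax : Continuous fun s => α - g (max (v s) (c * min (s - a) (b - s))) := by fun_prop
  have hleft : Continuous fun s => α - g (c * (s - a)) := by fun_prop
  have hright : Continuous fun s => α - g (c * (b - s)) := by fun_prop
  rw [← hc, abs_of_nonneg (intervalIntegral.integral_nonneg ht.1 fun s _ => h.deficit_nonneg _)]
  calc ∫ s in a..t, (α - g (max (v s) (c * min (s - a) (b - s))))
      ≤ ∫ s in a..b, (α - g (max (v s) (c * min (s - a) (b - s)))) :=
        intervalIntegral.integral_mono_interval le_rfl ht.1 ht.2
          (Eventually.of_forall fun s => h.deficit_nonneg _) (hmax.intervalIntegrable a b)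
    _ ≤ ∫ s in a..b, ((α - g (c * (s - a))) + (α - g (c * (b - s)))) := by
        refine intervalIntegral.integral_mono_on (ht.1.trans ht.2) (hmax.intervalIntegrable _ _)
          ((hleft.add hright).intervalIntegrable _ _) fun s _ => ?_
        have hmono := h.mono (le_max_right (v s) (c * min (s - a) (b - s)))
        have hl := h.deficit_nonneg (c * (s - a))
        have hr := h.deficit_nonneg (c * (b - s))
        rcases min_choice (s - a) (b - s) with hmin | hmin <;> rw [hmin] at hmono ⊢ <;> linarith
    _ = (∫ s in (0 : ℝ)..(b - a), (α - g (c * s))) + ∫ s in (0 : ℝ)..(b - a), (α - g (c * s)) := by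
        rw [intervalIntegral.integral_add (hleft.intervalIntegrable _ _)
            (hright.intervalIntegrable _ _),
          intervalIntegral.integral_comp_sub_right (fun s => α - g (c * s)) a,
          intervalIntegral.integral_comp_sub_left (fun s => α - g (c * s)) b, sub_self, sub_self]
    _ ≤ ε * (b - a) := by linarith [hc ▸ hd (b - a) hab]

lemma lipschitzWith_barrierForce (h : IsNormalized g g' p M α K) (κ a b t : ℝ) :
    LipschitzWith K (barrierForce g p κ a b t) := by
  have hmax : LipschitzWith K fun x => g (max x (κ * (b - a) * min (t - a) (b - t))) := by
    simpa [Function.comp_def] using h.lip.comp (LipschitzWith.id.max_const _)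
  have := (LipschitzWith.const (p t)).sub hmax
  rwa [zero_add] at this

lemma continuous_barrierForce (h : IsNormalized g g' p M α K) (κ a b : ℝ) {v : ℝ → ℝ}
    (hv : Continuous v) : Continuous fun t => barrierForce g p κ a b t (v t) := by
  have hg := h.continuous
  have hp := h.p_cont
  unfold barrierForce
  fun_prop

lemma abs_barrierForce_le (h : IsNormalized g g' p M α K) (κ a b t x : ℝ) :
    |barrierForce g p κ a b t x| ≤ 2 * M :=
  h.abs_force_le t _

lemma integral_barrierForce (h : IsNormalized g g' p M α K) (κ a b : ℝ) {v : ℝ → ℝ}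
    (hv : Continuous v) (s t : ℝ) :
    ∫ r in s..t, barrierForce g p κ a b r (v r) = (∫ r in s..t, p r) +
      (∫ r in s..t, (α - g (max (v r) (κ * (b - a) * min (r - a) (b - r))))) - α * (t - s) := by
  have hg := h.continuous
  have hdef : Continuous fun r => α - g (max (v r) (κ * (b - a) * min (r - a) (b - r))) := by
    fun_prop
  have hα : ∫ _ in s..t, α = α * (t - s) := by
    rw [intervalIntegral.integral_const, smul_eq_mul, mul_comm]
  rw [← hα, ← intervalIntegral.integral_add (h.p_cont.intervalIntegrable _ _)
    (hdef.intervalIntegrable _ _), ← intervalIntegral.integral_sub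
    (f := fun r => p r + (α - g (max (v r) (κ * (b - a) * min (r - a) (b - r)))))
    ((h.p_cont.add hdef).intervalIntegrable _ _) (continuous_const.intervalIntegrable _ _)]
  refine intervalIntegral.integral_congr fun r _ => ?_
  simp only [barrierForce]
  ring

/-- The barrier keeps `g(u)` close to `α` on most of `[a, b]`, so the velocity of any solution of
the modified equation is nearly affine, and shooting produces an arc. This arc stays above the
barrier, hence it solves the original equation. -/
theorem exists_isArc (h : IsNormalized g g' p M α K) {η : ℝ} (hη : 0 < η) (hηα : η ≤ α / 8) :
    ∃ τ > 0, ∀ a b, τ ≤ b - a → ∃ u u', IsArc (force g p) α η a b u u' := by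
  have hκ : 0 < α / 8 := by linarith
  obtain ⟨τ₁, hτ₁, hp⟩ := h.exists_integral_p_le (ε := η / 4) (by positivity)
  obtain ⟨τ₂, _, hd⟩ := h.exists_integral_max_deficit_le hκ (ε := η / 4) (by positivity)
  refine ⟨max τ₁ τ₂, lt_max_of_lt_left hτ₁, fun a b hab => ?_⟩
  have hlt : a < b := sub_pos.mp ((lt_max_of_lt_left hτ₁).trans_le hab)
  have hvel (u u' : ℝ → ℝ) (hu : IsSecondOrderSol (barrierForce g p (α / 8) a b) u u') (t : ℝ)
      (ht : t ∈ Icc a b) : |u' t - (u' a - α * (t - a))| ≤ η / 2 * (b - a) := by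
    have hint := intervalIntegral.integral_eq_sub_of_hasDerivAt (fun s _ => (hu s).2)
      ((h.continuous_barrierForce (α / 8) a b hu.continuous).intervalIntegrable a t)
    rw [h.integral_barrierForce _ _ _ hu.continuous] at hint
    have hp' := hp (b - a) ((le_max_left _ _).trans hab) a t
      (abs_le.mpr ⟨by linarith [ht.1], by linarith [ht.2]⟩)
    have hd' := hd a b ((le_max_right _ _).trans hab) u hu.continuous t ht
    rw [show u' t - (u' a - α * (t - a)) = (∫ s in a..t, p s) + ∫ s in a..t,
      (α - g (max (u s) (α / 8 * (b - a) * min (s - a) (b - s)))) by linarith]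
    exact (abs_add_le _ _).trans (by linarith)
  obtain ⟨u, u', hu⟩ := IsSecondOrderSol.exists_isArc_of_abs_deriv_sub_le
    (h.lipschitzWith_barrierForce (α / 8) a b)
    (fun x => h.continuous_barrierForce _ _ _ continuous_const)
    (h.abs_barrierForce_le (α / 8) a b) hlt hvel
  rw [mul_div_cancel₀ η two_ne_zero] at hu
  obtain ⟨w, w', hw, hwa, hw'a⟩ := h.exists_sol a 0 (u' a)
  have heq := hu.sol.eqOn_Icc_of_eqOn_rhs h.lipschitzWith_force hw (b := b)
    (hu.left.trans hwa.symm) hw'a.symm fun t ht => by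
      rw [barrierForce, max_eq_left (hu.lower h.pos hηα ht)]
  exact ⟨w, w', hw, hwa, (heq b (right_mem_Icc.mpr hlt.le)).1 ▸ hu.right,
    fun s hs => (heq s hs).2 ▸ hu.deriv_le s hs⟩

end IsNormalized

section MaximumPrinciple

lemma nonneg_second_deriv_of_isLocalMin {y y' : ℝ → ℝ} {s y'' : ℝ}
    (hy : ∀ t, HasDerivAt y (y' t) t) (hy' : HasDerivAt y' y'' s) (hmin : IsLocalMin y s) :
    0 ≤ y'' := by
  by_contra! hneg
  have hderiv : deriv y = y' := funext fun t => (hy t).deriv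
  have hmax : IsLocalMax y s := isLocalMax_of_deriv_deriv_neg (by rwa [hderiv, hy'.deriv])
    hmin.deriv_eq_zero (hy s).continuousAt
  have hconst : y =ᶠ[𝓝 s] fun _ => y s := by
    filter_upwards [hmin, hmax] with t h₁ h₂ using le_antisymm h₂ h₁
  have hzero : deriv (deriv y) s = 0 := by
    rw [hconst.deriv.deriv_eq]
    simp
  rw [hderiv, hy'.deriv] at hzero
  exact hneg.ne hzero

lemma le_mul_of_forall_mul_second_deriv_lt {z z' z'' ψ ψ' ψ'' : ℝ → ℝ} {c d δ : ℝ}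
    (hz : ∀ s, HasDerivAt z (z' s) s) (hz' : ∀ s, HasDerivAt z' (z'' s) s)
    (hψ : ∀ s, HasDerivAt ψ (ψ' s) s) (hψ' : ∀ s, HasDerivAt ψ' (ψ'' s) s)
    (hpos : ∀ s ∈ Icc c d, 0 < ψ s) (hc : z c ≤ δ * ψ c) (hd : z d ≤ δ * ψ d)
    (hlt : ∀ s ∈ Ioo c d, ∀ L, δ < L → z s = L * ψ s → L * ψ'' s < z'' s) :
    ∀ s ∈ Icc c d, z s ≤ δ * ψ s := by
  intro s hs
  have hcont : ContinuousOn (fun s => z s / ψ s) (Icc c d) :=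
    (HasDerivAt.continuousOn fun s _ => hz s).div (HasDerivAt.continuousOn fun s _ => hψ s)
      fun s hs => (hpos s hs).ne'
  obtain ⟨m, hm, hmax⟩ := isCompact_Icc.exists_isMaxOn ⟨s, hs⟩ hcont
  obtain ⟨L, hL⟩ : ∃ L, L = z m / ψ m := ⟨_, rfl⟩
  have htouch : z m = L * ψ m := by rw [hL, div_mul_cancel₀ _ (hpos m hm).ne']
  have hle (s : ℝ) (hs : s ∈ Icc c d) : z s ≤ L * ψ s := by
    rw [← div_le_iff₀ (hpos s hs), hL]
    exact hmax hs
  suffices hLδ : L ≤ δ from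
    (hle s hs).trans (mul_le_mul_of_nonneg_right hLδ (hpos s hs).le)
  by_contra! hδL
  have hbelow (hend : z m ≤ δ * ψ m) : False :=
    hδL.not_ge (le_of_mul_le_mul_right (htouch ▸ hend) (hpos m hm))
  have hcm : c < m := hm.1.lt_of_ne (by rintro rfl; exact hbelow hc)
  have hmd : m < d := hm.2.lt_of_ne (by rintro rfl; exact hbelow hd)
  have hmin : IsLocalMin (fun s => L * ψ s - z s) m := by
    filter_upwards [Icc_mem_nhds hcm hmd] with s hs
    linarith [hle s hs]
  have := nonneg_second_deriv_of_isLocalMin (fun s => ((hψ s).const_mul L).sub (hz s))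
    (((hψ' m).const_mul L).sub (hz' m)) hmin
  linarith [hlt m ⟨hcm, hmd⟩ L hδL htouch]

end MaximumPrinciple

namespace IsNormalized

variable {g g' p : ℝ → ℝ} {M α : ℝ} {K : NNReal}

lemma sub_le_deriv_mul (h : IsNormalized g g' p M α K) {x y φ : ℝ} (hφ : 0 ≤ φ) (hx : φ ≤ x)
    (hxy : x < y) : g y - g x ≤ g' φ * (y - x) := by
  obtain ⟨ξ, hξ, hslope⟩ := exists_hasDerivAt_eq_slope g g' hxy h.continuous.continuousOn
    fun t _ => h.hasDerivAt t
  have hφξ : φ ≤ ξ := hx.trans hξ.1.le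
  rw [eq_div_iff (sub_pos.mpr hxy).ne'] at hslope
  rw [← hslope]
  exact mul_le_mul_of_nonneg_right (h.anti hφ (hφ.trans hφξ) hφξ) (sub_pos.mpr hxy).le

lemma exists_concave_primitive (h : IsNormalized g g' p M α K) {κ : ℝ} (hκ : 0 < κ) :
    ∃ τ > 0, ∀ T, τ ≤ T → ∃ l l' : ℝ → ℝ, (∀ x, HasDerivAt l (l' x) x) ∧
      (∀ x, HasDerivAt l' (-(2 * g' (κ * T * x))) x) ∧ ∀ x ∈ Icc 0 T, l x ∈ Icc 0 (1 / 4) := by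
  obtain ⟨τ, hτ, hd⟩ := h.exists_integral_deficit_le hκ (ε := κ / 8) (by positivity)
  refine ⟨τ, hτ, fun T hT => ?_⟩
  have hT₀ : 0 < T := hτ.trans_le hT
  have hcont : Continuous fun r => α - g (κ * T * r) :=
    continuous_const.sub (h.continuous.comp (by fun_prop))
  refine ⟨fun x => 2 / (κ * T) * ∫ r in (0 : ℝ)..x, (α - g (κ * T * r)),
    fun x => 2 / (κ * T) * (α - g (κ * T * x)), fun x => ?_, fun x => ?_, fun x hx => ?_⟩
  · exact (hcont.integral_hasStrictDerivAt 0 x).hasDerivAt.const_mul _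
  · have := (h.hasDerivAt (κ * T * x)).comp x ((hasDerivAt_id x).const_mul (κ * T))
    refine ((this.const_sub α).const_mul (2 / (κ * T))).congr_deriv ?_
    field_simp
  · have hle : ∫ r in (0 : ℝ)..x, (α - g (κ * T * r)) ≤ κ / 8 * T :=
      (intervalIntegral.integral_mono_interval le_rfl hx.1 hx.2
        (Eventually.of_forall fun r => h.deficit_nonneg _) (hcont.intervalIntegrable 0 T)).trans
        (hd T hT)
    refine ⟨mul_nonneg (by positivity)
      (intervalIntegral.integral_nonneg hx.1 fun r _ => h.deficit_nonneg _), ?_⟩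
    calc 2 / (κ * T) * ∫ r in (0 : ℝ)..x, (α - g (κ * T * r))
        ≤ 2 / (κ * T) * (κ / 8 * T) := by gcongr
      _ = 1 / 4 := by field_simp; norm_num

lemma exists_supersolution (h : IsNormalized g g' p M α K) {κ : ℝ} (hκ : 0 < κ) :
    ∃ τ > 0, ∀ c d, τ ≤ d - c → ∃ ψ ψ' : ℝ → ℝ, (∀ s, HasDerivAt ψ (ψ' s) s) ∧
      (∀ s, HasDerivAt ψ' (-(2 * (g' (κ * (d - c) * (s - c)) + g' (κ * (d - c) * (d - s))))) s) ∧
      ∀ s ∈ Icc c d, ψ s ∈ Icc 1 (3 / 2) := by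
  obtain ⟨τ, hτ, hl⟩ := h.exists_concave_primitive hκ
  refine ⟨τ, hτ, fun c d hcd => ?_⟩
  obtain ⟨l, l', hl, hl', hbd⟩ := hl (d - c) hcd
  refine ⟨fun s => 1 + l (s - c) + l (d - s), fun s => l' (s - c) - l' (d - s), fun s => ?_,
    fun s => ?_, fun s hs => ?_⟩
  · have hleft := (hl (s - c)).comp s ((hasDerivAt_id s).sub_const c)
    have hright := (hl (d - s)).comp s ((hasDerivAt_id s).const_sub d)
    refine ((hleft.const_add 1).add hright).congr_deriv ?_
    ring
  · have hleft := (hl' (s - c)).comp s ((hasDerivAt_id s).sub_const c)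
    have hright := (hl' (d - s)).comp s ((hasDerivAt_id s).const_sub d)
    refine (hleft.sub hright).congr_deriv ?_
    ring
  · obtain ⟨h₁, h₂⟩ := hbd (s - c) ⟨by linarith [hs.1], by linarith [hs.2]⟩
    obtain ⟨h₃, h₄⟩ := hbd (d - s) ⟨by linarith [hs.2], by linarith [hs.1]⟩
    constructor <;> linarith

/-- `u - w` is compared with multiples of the supersolution `ψ`: where the two touch, concavity
bounds `(u - w)'' = g(w) - g(u)` below by `-g'(φ) (u - w)`, which exceeds `L ψ''`. -/
lemma exists_sub_le_of_boundary (h : IsNormalized g g' p M α K) {κ : ℝ} (hκ : 0 < κ) :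
    ∃ τ > 0, ∀ c d, τ ≤ d - c → ∀ u u' w w',
      IsSecondOrderSol (force g p) u u' → IsSecondOrderSol (force g p) w w' →
      (∀ s ∈ Icc c d, κ * (d - c) * min (s - c) (d - s) ≤ w s) →
      ∀ δ, |u c - w c| ≤ δ → |u d - w d| ≤ δ → ∀ s ∈ Icc c d, u s - w s ≤ 2 * δ := by
  obtain ⟨τ, hτ, hb⟩ := h.exists_supersolution hκ
  refine ⟨τ, hτ, fun c d hcd u u' w w' hu hw hwl δ hc hd s hs => ?_⟩
  obtain ⟨ψ, ψ', hψ, hψ', hψb⟩ := hb c d hcd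
  have hcd₀ : 0 < d - c := hτ.trans_le hcd
  have hδ : 0 ≤ δ := (abs_nonneg _).trans hc
  suffices hle : u s - w s ≤ δ * ψ s by
    linarith [mul_le_mul_of_nonneg_left (hψb s hs).2 hδ]
  refine le_mul_of_forall_mul_second_deriv_lt (z := fun s => u s - w s)
    (fun s => (hu s).1.sub (hw s).1) (fun s => (hu s).2.sub (hw s).2) hψ hψ'
    (fun s hs => zero_lt_one.trans_le (hψb s hs).1) ?_ ?_ (fun m hm L hL htouch => ?_) s hs
  · exact (le_abs_self _).trans (hc.trans
      (le_mul_of_one_le_right hδ (hψb c (left_mem_Icc.mpr (sub_nonneg.mp hcd₀.le))).1))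
  · exact (le_abs_self _).trans (hd.trans
      (le_mul_of_one_le_right hδ (hψb d (right_mem_Icc.mpr (sub_nonneg.mp hcd₀.le))).1))
  have hm' := Ioo_subset_Icc_self hm
  have hL₀ : 0 < L := hδ.trans_lt hL
  have hleft : 0 ≤ κ * (d - c) * (m - c) := mul_nonneg (by positivity) (sub_nonneg.mpr hm'.1)
  have hright : 0 ≤ κ * (d - c) * (d - m) := mul_nonneg (by positivity) (sub_nonneg.mpr hm'.2)
  obtain ⟨φ, hφ⟩ : ∃ φ, φ = κ * (d - c) * min (m - c) (d - m) := ⟨_, rfl⟩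
  have hφ₀ : 0 ≤ φ := by
    rcases min_choice (m - c) (d - m) with hmin | hmin <;> rw [hφ, hmin] <;> assumption
  have hq : g' φ < g' (κ * (d - c) * (m - c)) + g' (κ * (d - c) * (d - m)) := by
    have hpos₁ := h.deriv_pos _ hleft
    have hpos₂ := h.deriv_pos _ hright
    rcases min_choice (m - c) (d - m) with hmin | hmin <;> rw [hφ, hmin] <;> linarith
  have hgap : 0 < u m - w m := htouch ▸ mul_pos hL₀ (zero_lt_one.trans_le (hψb m hm').1)
  have hslope := h.sub_le_deriv_mul hφ₀ (hφ ▸ hwl m hm') (sub_pos.mp hgap)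
  rw [htouch] at hslope
  have hψm : g' φ * (L * ψ m) ≤ g' φ * (L * (3 / 2)) := by
    have := h.deriv_pos φ hφ₀
    gcongr
    exact (hψb m hm').2
  linarith [mul_lt_mul_of_pos_left hq hL₀, mul_pos hL₀ (h.deriv_pos φ hφ₀)]

theorem exists_abs_sub_le_of_boundary (h : IsNormalized g g' p M α K) {κ : ℝ} (hκ : 0 < κ) :
    ∃ τ > 0, ∀ c d, τ ≤ d - c → ∀ u u' w w',
      IsSecondOrderSol (force g p) u u' → IsSecondOrderSol (force g p) w w' →
      (∀ s ∈ Icc c d, κ * (d - c) * min (s - c) (d - s) ≤ u s) →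
      (∀ s ∈ Icc c d, κ * (d - c) * min (s - c) (d - s) ≤ w s) →
      ∀ δ, |u c - w c| ≤ δ → |u d - w d| ≤ δ → ∀ s ∈ Icc c d, |u s - w s| ≤ 2 * δ := by
  obtain ⟨τ, hτ, hle⟩ := h.exists_sub_le_of_boundary hκ
  refine ⟨τ, hτ, fun c d hcd u u' w w' hu hw hul hwl δ hc hd s hs => abs_sub_le_iff.mpr
    ⟨hle c d hcd u u' w w' hu hw hwl δ hc hd s hs,
      hle c d hcd w w' u u' hw hu hul δ ?_ ?_ s hs⟩⟩
  · rwa [abs_sub_comm]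
  · rwa [abs_sub_comm]

end IsNormalized

section MeanValue

lemma abs_sub_le_of_abs_deriv_le {f f' : ℝ → ℝ} {S : Set ℝ} {V x y : ℝ} (hS : Convex ℝ S)
    (hf : ∀ t ∈ S, HasDerivAt f (f' t) t) (hV : ∀ t ∈ S, |f' t| ≤ V) (hx : x ∈ S) (hy : y ∈ S) :
    |f y - f x| ≤ V * |y - x| :=
  hS.norm_image_sub_le_of_norm_hasDerivWithin_le (fun t ht => (hf t ht).hasDerivWithinAt) hV hx hy

lemma abs_sub_le_of_zeros {f f' k k' : ℝ → ℝ} {S : Set ℝ} {V x y c : ℝ} (hS : Convex ℝ S)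
    (hf : ∀ t ∈ S, HasDerivAt f (f' t) t) (hfV : ∀ t ∈ S, |f' t| ≤ V) (hfx : f x = 0)
    (hk : ∀ t ∈ S, HasDerivAt k (k' t) t) (hkV : ∀ t ∈ S, |k' t| ≤ V) (hky : k y = 0)
    (hx : x ∈ S) (hy : y ∈ S) (hc : c ∈ uIcc x y) : |f c - k c| ≤ V * |y - x| := by
  have hcS : c ∈ S := hS.ordConnected.uIcc_subset hx hy hc
  have hfc := abs_sub_le_of_abs_deriv_le hS hf hfV hx hcS
  have hkc := abs_sub_le_of_abs_deriv_le hS hk hkV hy hcS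
  rw [hfx, sub_zero] at hfc
  rw [hky, sub_zero] at hkc
  calc |f c - k c| ≤ |f c| + |k c| := abs_sub _ _
    _ ≤ V * |c - x| + V * |c - y| := add_le_add hfc hkc
    _ = V * |y - x| := by
      rw [← mul_add, add_comm, abs_sub_comm c y]
      rcases mem_uIcc.mp hc with ⟨h₁, h₂⟩ | ⟨h₁, h₂⟩
      · rw [abs_of_nonneg (sub_nonneg.mpr h₂), abs_of_nonneg (sub_nonneg.mpr h₁),
          abs_of_nonneg (sub_nonneg.mpr (h₁.trans h₂)), sub_add_sub_cancel]
      · rw [abs_of_nonpos (sub_nonpos.mpr h₁), abs_of_nonpos (sub_nonpos.mpr h₂),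
          abs_of_nonpos (sub_nonpos.mpr (h₁.trans h₂)), ← neg_add, sub_add_sub_cancel]

lemma exists_abs_deriv_le_div {f f' : ℝ → ℝ} {c d B : ℝ} (hcd : c < d)
    (hf : ∀ t, HasDerivAt f (f' t) t) (hc : |f c| ≤ B) (hd : |f d| ≤ B) :
    ∃ ξ ∈ Ioo c d, |f' ξ| ≤ 2 * B / (d - c) := by
  obtain ⟨ξ, hξ, hslope⟩ := exists_hasDerivAt_eq_slope f f' hcd
    (fun t _ => (hf t).continuousAt.continuousWithinAt) fun t _ => hf t
  refine ⟨ξ, hξ, ?_⟩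
  rw [hslope, abs_div, abs_of_pos (sub_pos.mpr hcd)]
  exact div_le_div_of_nonneg_right (by linarith [abs_sub (f d) (f c)]) (sub_nonneg.mpr hcd.le)

lemma abs_integral_sub_const_mul_le {f : ℝ → ℝ} {a b c B : ℝ}
    (hf : IntervalIntegrable f MeasureTheory.volume a b) (hB : ∀ s ∈ uIcc a b, |f s - c| ≤ B) :
    |(∫ s in a..b, f s) - c * (b - a)| ≤ B * |b - a| := by
  have heq : (∫ s in a..b, f s) - c * (b - a) = ∫ s in a..b, (f s - c) := by
    rw [intervalIntegral.integral_sub hf (by simp), intervalIntegral.integral_const, smul_eq_mul,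
      mul_comm]
  rw [heq]
  exact intervalIntegral.norm_integral_le_of_norm_le_const (f := fun s => f s - c)
    fun s hs => hB s (uIoc_subset_uIcc hs)

end MeanValue

/-- The primitive of `g` vanishing at `0`. -/
noncomputable def potential (g : ℝ → ℝ) (x : ℝ) : ℝ := ∫ r in (0 : ℝ)..x, g r

section Potential

variable {g : ℝ → ℝ}

lemma hasDerivAt_potential (hg : Continuous g) (x : ℝ) : HasDerivAt (potential g) (g x) x :=
  (hg.integral_hasStrictDerivAt 0 x).hasDerivAt

lemma continuous_potential (hg : Continuous g) : Continuous (potential g) :=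
  continuous_iff_continuousAt.mpr fun x => (hasDerivAt_potential hg x).continuousAt

lemma abs_potential_le {M : ℝ} (hM : ∀ x, |g x| ≤ M) (x : ℝ) : |potential g x| ≤ M * |x| := by
  simpa [potential] using intervalIntegral.norm_integral_le_of_norm_le_const (a := 0) (b := x)
    (f := g) fun r _ => hM r

lemma abs_potential_sub_le {K : NNReal} (hg : LipschitzWith K g) (x y : ℝ) :
    |potential g y - potential g x - g x * (y - x)| ≤ K * (y - x) ^ 2 := by
  have hint (a b : ℝ) := hg.continuous.intervalIntegrable (μ := MeasureTheory.volume) a b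
  have := abs_integral_sub_const_mul_le (hint x y) (c := g x) (B := K * |y - x|) fun r hr => by
    have := hg.dist_le_mul r x
    rw [Real.dist_eq, Real.dist_eq] at this
    exact this.trans (mul_le_mul_of_nonneg_left (abs_sub_left_of_mem_uIcc hr) K.2)
  rwa [mul_assoc, ← sq, sq_abs, ← intervalIntegral.integral_interval_sub_left (hint 0 y) (hint 0 x)]
    at this

end Potential

/-- The Lagrangian of `ü + g(u) = p(t)` along `u`, with `u'` in the role of the velocity. -/
noncomputable def lagrangian (g p u u' : ℝ → ℝ) (s : ℝ) : ℝ :=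
  u' s ^ 2 / 2 - potential g (u s) + p s * u s

/-- The action of `u` on `[a, b]`. -/
noncomputable def action (g p u u' : ℝ → ℝ) (a b : ℝ) : ℝ :=
  ∫ s in a..b, lagrangian g p u u' s

lemma abs_lagrangian_sub_le {g : ℝ → ℝ} {K : NNReal} (hg : LipschitzWith K g)
    (p u u' w w' : ℝ → ℝ) (s : ℝ) :
    |lagrangian g p w w' s - lagrangian g p u u' s
        - (force g p s (u s) * (w s - u s) + u' s * (w' s - u' s))|
      ≤ (w' s - u' s) ^ 2 / 2 + K * (w s - u s) ^ 2 := by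
  have heq : lagrangian g p w w' s - lagrangian g p u u' s
        - (force g p s (u s) * (w s - u s) + u' s * (w' s - u' s))
      = (w' s - u' s) ^ 2 / 2
        - (potential g (w s) - potential g (u s) - g (u s) * (w s - u s)) := by
    unfold lagrangian
    ring
  rw [heq]
  refine (abs_sub _ _).trans (add_le_add (abs_of_nonneg (by positivity)).le ?_)
  exact abs_potential_sub_le hg _ _

namespace IsNormalized

variable {g g' p : ℝ → ℝ} {M α η a b a' b' : ℝ} {K : NNReal} {u u' w w' : ℝ → ℝ}

lemma continuous_lagrangian (h : IsNormalized g g' p M α K)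
    (hu : IsSecondOrderSol (force g p) u u') : Continuous (lagrangian g p u u') :=
  (((hu.continuous_deriv.pow 2).div_const 2).sub
    ((continuous_potential h.continuous).comp hu.continuous)).add (h.p_cont.mul hu.continuous)

lemma action_add_action (h : IsNormalized g g' p M α K) (hu : IsSecondOrderSol (force g p) u u')
    (r s t : ℝ) : action g p u u' r s + action g p u u' s t = action g p u u' r t :=
  intervalIntegral.integral_add_adjacent_intervals
    ((h.continuous_lagrangian hu).intervalIntegrable _ _)
    ((h.continuous_lagrangian hu).intervalIntegrable _ _)

lemma continuous_force_comp (h : IsNormalized g g' p M α K) (hu : Continuous u) :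
    Continuous fun s => force g p s (u s) :=
  h.p_cont.sub (h.continuous.comp hu)

lemma abs_deriv_sub_le (h : IsNormalized g g' p M α K)
    (hu : IsSecondOrderSol (force g p) u u') (s t : ℝ) : |u' t - u' s| ≤ 2 * M * |t - s| :=
  abs_sub_le_of_abs_deriv_le convex_univ (fun x _ => (hu x).2) (fun x _ => h.abs_force_le x (u x))
    (mem_univ s) (mem_univ t)

lemma abs_action_sub_mul_le (h : IsNormalized g g' p M α K)
    (hw : IsSecondOrderSol (force g p) w w') {v V B : ℝ} (hwa : w a' = 0) (hv : |v| ≤ V)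
    (hV : ∀ s ∈ uIcc a a', |w' s| ≤ V) (hB : ∀ s ∈ uIcc a a', |w' s - v| ≤ B) :
    |action g p w w' a a' - v ^ 2 / 2 * (a' - a)| ≤ (B * V + 2 * M * V * |a' - a|) * |a' - a| := by
  have hM := h.bound_pos
  have hV₀ : 0 ≤ V := (abs_nonneg _).trans hv
  refine abs_integral_sub_const_mul_le ((h.continuous_lagrangian hw).intervalIntegrable _ _)
    fun s hs => ?_
  have hws : |w s| ≤ V * |a' - a| := by
    have := abs_sub_le_of_abs_deriv_le (convex_uIcc a a') (fun t _ => (hw t).1) hV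
      right_mem_uIcc hs
    rw [hwa, sub_zero, abs_sub_comm] at this
    exact this.trans (mul_le_mul_of_nonneg_left (abs_sub_right_of_mem_uIcc hs) hV₀)
  have hkin : |(w' s - v) * ((w' s + v) / 2)| ≤ B * V := by
    rw [abs_mul]
    refine mul_le_mul (hB s hs) ?_ (abs_nonneg _) ((abs_nonneg _).trans (hB s hs))
    rw [abs_div, abs_two]
    linarith [abs_add_le (w' s) v, hV s hs]
  have hpot : |potential g (w s)| ≤ M * (V * |a' - a|) :=
    (abs_potential_le h.bdd _).trans (mul_le_mul_of_nonneg_left hws hM.le)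
  have hforce : |p s * w s| ≤ M * (V * |a' - a|) := by
    rw [abs_mul]
    exact mul_le_mul (h.p_bdd s) hws (abs_nonneg _) hM.le
  calc |lagrangian g p w w' s - v ^ 2 / 2|
      = |(w' s - v) * ((w' s + v) / 2) - potential g (w s) + p s * w s| := by
        unfold lagrangian
        ring_nf
    _ ≤ |(w' s - v) * ((w' s + v) / 2)| + |potential g (w s)| + |p s * w s| :=
        (abs_add_le _ _).trans (add_le_add_left (abs_sub _ _) _)
    _ ≤ B * V + 2 * M * V * |a' - a| := by linarith

/-- First variation: the linear term is a total derivative because `u` is an extremal. -/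
lemma abs_action_sub_action_le (h : IsNormalized g g' p M α K)
    (hu : IsSecondOrderSol (force g p) u u') (hw : IsSecondOrderSol (force g p) w w') {δ : ℝ}
    (hab : a ≤ b) (hδ : ∀ s ∈ Icc a b, |w s - u s| ≤ δ ∧ |w' s - u' s| ≤ δ) :
    |action g p w w' a b - action g p u u' a b - (u' b * (w b - u b) - u' a * (w a - u a))|
      ≤ (1 + K) * δ ^ 2 * (b - a) := by
  have hcu := h.continuous_lagrangian hu
  have hcw := h.continuous_lagrangian hw
  have hcd : Continuous fun s => force g p s (u s) * (w s - u s) + u' s * (w' s - u' s) :=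
    ((h.continuous_force_comp hu.continuous).mul (hw.continuous.sub hu.continuous)).add
      (hu.continuous_deriv.mul (hw.continuous_deriv.sub hu.continuous_deriv))
  have hlin : ∫ s in a..b, (force g p s (u s) * (w s - u s) + u' s * (w' s - u' s))
      = u' b * (w b - u b) - u' a * (w a - u a) :=
    intervalIntegral.integral_eq_sub_of_hasDerivAt
      (fun s _ => (hu s).2.mul ((hw s).1.sub (hu s).1)) (hcd.intervalIntegrable _ _)
  have hpt (s : ℝ) (hs : s ∈ Icc a b) : |lagrangian g p w w' s - lagrangian g p u u' s
      - (force g p s (u s) * (w s - u s) + u' s * (w' s - u' s))| ≤ (1 + K) * δ ^ 2 := by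
    have hpos := sq_le_sq' (abs_le.mp (hδ s hs).1).1 (abs_le.mp (hδ s hs).1).2
    have hvel := sq_le_sq' (abs_le.mp (hδ s hs).2).1 (abs_le.mp (hδ s hs).2).2
    refine (abs_lagrangian_sub_le h.lip p u u' w w' s).trans ?_
    linarith [mul_le_mul_of_nonneg_left hpos K.coe_nonneg, sq_nonneg δ]
  calc |action g p w w' a b - action g p u u' a b - (u' b * (w b - u b) - u' a * (w a - u a))|
      = |∫ s in a..b, (lagrangian g p w w' s - lagrangian g p u u' s
          - (force g p s (u s) * (w s - u s) + u' s * (w' s - u' s)))| := by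
        rw [intervalIntegral.integral_sub
          (f := fun s => lagrangian g p w w' s - lagrangian g p u u' s)
          ((hcw.sub hcu).intervalIntegrable _ _) (hcd.intervalIntegrable _ _),
          intervalIntegral.integral_sub (hcw.intervalIntegrable _ _)
            (hcu.intervalIntegrable _ _), hlin, action, action]
    _ ≤ (1 + K) * δ ^ 2 * |b - a| := by
        rw [← Real.norm_eq_abs]
        refine intervalIntegral.norm_integral_le_of_norm_le_const fun s hs => hpt s ?_
        rw [uIoc_of_le hab] at hs
        exact Ioc_subset_Icc_self hs
    _ = (1 + K) * δ ^ 2 * (b - a) := by rw [abs_of_nonneg (sub_nonneg.mpr hab)]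

end IsNormalized

lemma IsArc.lower_of_mem_Icc {F : ℝ → ℝ → ℝ} {u u' : ℝ → ℝ} {α η a b c d s : ℝ}
    (h : IsArc F α η a b u u') (hα : 0 < α) (hη : η ≤ α / 8) (hac : a ≤ c) (hdb : d ≤ b)
    (hs : s ∈ Icc c d) : α / 8 * (d - c) * min (s - c) (d - s) ≤ u s := by
  refine le_trans ?_ (h.lower hα hη ⟨hac.trans hs.1, hs.2.trans hdb⟩)
  have hmin : 0 ≤ min (s - c) (d - s) := le_min (sub_nonneg.mpr hs.1) (sub_nonneg.mpr hs.2)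
  have hab : 0 ≤ b - a := by linarith [hs.1, hs.2]
  gcongr

lemma IsArc.abs_deriv_le {F : ℝ → ℝ → ℝ} {u u' : ℝ → ℝ} {α η a b s : ℝ}
    (h : IsArc F α η a b u u') (hα : 0 < α) (hη : η ≤ α / 8) (hs : s ∈ Icc a b) :
    |u' s| ≤ α * (b - a) := by
  have hab : 0 ≤ b - a := by linarith [hs.1, hs.2]
  have hdev := (h.deriv_le s hs).trans (mul_le_mul_of_nonneg_right hη hab)
  have hpar : |α * ((a + b) / 2 - s)| ≤ α * ((b - a) / 2) := by
    rw [abs_mul, abs_of_pos hα]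
    exact mul_le_mul_of_nonneg_left (abs_le.mpr ⟨by linarith [hs.2], by linarith [hs.1]⟩) hα.le
  have := mul_nonneg hα.le hab
  linarith [abs_sub_abs_le_abs_sub (u' s) (α * ((a + b) / 2 - s))]

namespace IsNormalized

variable {g g' p : ℝ → ℝ} {M α η : ℝ} {K : NNReal}

lemma abs_arc_deriv_le (h : IsNormalized g g' p M α K) (hη : η ≤ α / 8) {a b c d s : ℝ}
    {u u' : ℝ → ℝ} (hu : IsArc (force g p) α η a b u u') (hab : a ≤ b) (hca : c ≤ a)
    (hbd : b ≤ d) (hs : s ∈ Icc c d) : |u' s| ≤ (α + 2 * M) * (d - c) := by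
  have hα := h.pos
  have hM := h.bound_pos
  have hleft : |u' a| ≤ α * (b - a) := hu.abs_deriv_le hα hη (left_mem_Icc.mpr hab)
  have hsa : |s - a| ≤ d - c := abs_le.mpr ⟨by linarith [hs.1], by linarith [hs.2]⟩
  calc |u' s| ≤ |u' s - u' a| + |u' a| := by linarith [abs_sub_abs_le_abs_sub (u' s) (u' a)]
    _ ≤ 2 * M * |s - a| + α * (b - a) := add_le_add (h.abs_deriv_sub_le hu.sol a s) hleft
    _ ≤ 2 * M * (d - c) + α * (d - c) := by gcongr
    _ = (α + 2 * M) * (d - c) := by ring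

/-- Positions are close by the maximum principle, so velocities are close somewhere by the mean
value theorem, and from there on Grönwall's inequality applies. -/
lemma exists_abs_sub_le_of_boundary_of_mem_Icc (h : IsNormalized g g' p M α K) {κ : ℝ}
    (hκ : 0 < κ) :
    ∃ τ > 0, ∀ c d, τ ≤ d - c → ∀ u u' w w',
      IsSecondOrderSol (force g p) u u' → IsSecondOrderSol (force g p) w w' →
      (∀ s ∈ Icc c d, κ * (d - c) * min (s - c) (d - s) ≤ u s) →
      (∀ s ∈ Icc c d, κ * (d - c) * min (s - c) (d - s) ≤ w s) →
      ∀ δ, |u c - w c| ≤ δ → |u d - w d| ≤ δ → ∀ e f, e ≤ c → d ≤ f → ∀ s ∈ Icc e f,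
        |u s - w s| ≤ (2 + 2 / τ) * Real.exp (max 1 K * (f - e)) * δ ∧
          |u' s - w' s| ≤ (2 + 2 / τ) * Real.exp (max 1 K * (f - e)) * δ := by
  obtain ⟨τ, hτ, hstab⟩ := h.exists_abs_sub_le_of_boundary hκ
  refine ⟨τ, hτ, fun c d hcd u u' w w' hu hw hul hwl δ hc hd e f hec hdf s hs => ?_⟩
  have hδ : 0 ≤ δ := (abs_nonneg _).trans hc
  obtain ⟨ξ, hξ, hvel⟩ := exists_abs_deriv_le_div (sub_pos.mp (hτ.trans_le hcd))
    (fun t => (hu t).1.sub (hw t).1) hc hd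
  have hpos := hstab c d hcd u u' w w' hu hw hul hwl δ hc hd ξ (Ioo_subset_Icc_self hξ)
  have hdiv : 2 * δ / (d - c) ≤ 2 / τ * δ := by
    rw [div_mul_eq_mul_div]
    gcongr
  have hτδ : 0 ≤ 2 / τ * δ := by positivity
  have hgron := hu.abs_sub_le h.lipschitzWith_force hw (δ := (2 + 2 / τ) * δ)
    (hpos.trans (by linarith)) (hvel.trans (by linarith)) s
  have hsξ : |s - ξ| ≤ f - e :=
    abs_le.mpr ⟨by linarith [hs.1, hξ.2], by linarith [hs.2, hξ.1]⟩
  have hexp : (2 + 2 / τ) * δ * Real.exp (max 1 K * |s - ξ|)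
      ≤ (2 + 2 / τ) * Real.exp (max 1 K * (f - e)) * δ := by
    rw [mul_right_comm]
    gcongr
  exact ⟨hgron.1.trans hexp, hgron.2.trans hexp⟩

theorem exists_arc_close (h : IsNormalized g g' p M α K) :
    ∃ τ > 0, ∀ η ≤ α / 8, ∀ a b, τ < b - a → ∃ C, ∃ δ₀ > 0, δ₀ ≤ 1 ∧
      ∀ a' b' δ, |a' - a| ≤ δ → |b' - b| ≤ δ → δ ≤ δ₀ → a' ≤ b' ∧
        ∀ u u' w w', IsArc (force g p) α η a b u u' → IsArc (force g p) α η a' b' w w' →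
          ∀ s ∈ Icc (a - 1) (b + 1), |w s - u s| ≤ C * δ ∧ |w' s - u' s| ≤ C * δ := by
  have hα := h.pos
  have hM := h.bound_pos
  obtain ⟨τ, hτ, hstab⟩ := h.exists_abs_sub_le_of_boundary_of_mem_Icc (κ := α / 8) (by positivity)
  refine ⟨τ, hτ, fun η hη a b hab => ?_⟩
  have hlen : 0 ≤ b + 1 - (a - 1) := by linarith
  refine ⟨(2 + 2 / τ) * Real.exp (max 1 K * (b + 1 - (a - 1)))
    * ((α + 2 * M) * (b + 1 - (a - 1))), min 1 ((b - a - τ) / 2),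
    lt_min one_pos (by linarith), min_le_left _ _, fun a' b' δ ha hb hδ => ?_⟩
  obtain ⟨hδ₁, hδτ⟩ := le_min_iff.mp hδ
  obtain ⟨ha₁, ha₂⟩ := abs_le.mp ha
  obtain ⟨hb₁, hb₂⟩ := abs_le.mp hb
  have hab' : a' ≤ b' := by linarith
  refine ⟨hab', fun u u' w w' hu hw s hs => ?_⟩
  have huV (s : ℝ) := h.abs_arc_deriv_le hη hu (c := a - 1) (d := b + 1) (s := s)
    (by linarith) (by linarith) (by linarith)
  have hwV (s : ℝ) := h.abs_arc_deriv_le hη hw (c := a - 1) (d := b + 1) (s := s)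
    hab' (by linarith) (by linarith)
  have hzero {x y c : ℝ} (hux : u x = 0) (hwy : w y = 0) (hx : x ∈ Icc (a - 1) (b + 1))
      (hy : y ∈ Icc (a - 1) (b + 1)) (hc : c ∈ uIcc x y) (hxy : |y - x| ≤ δ) :
      |u c - w c| ≤ (α + 2 * M) * (b + 1 - (a - 1)) * δ :=
    (abs_sub_le_of_zeros (convex_Icc _ _) (fun t _ => (hu.sol t).1) huV hux
      (fun t _ => (hw.sol t).1) hwV hwy hx hy hc).trans
        (mul_le_mul_of_nonneg_left hxy (by positivity))
  have hcd : τ ≤ min b b' - max a a' := by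
    linarith [le_min (by linarith : b - δ ≤ b) (by linarith : b - δ ≤ b'),
      max_le (by linarith : a ≤ a + δ) (by linarith : a' ≤ a + δ)]
  rw [abs_sub_comm (w s), abs_sub_comm (w' s), mul_assoc _ (_ * _) δ]
  exact hstab _ _ hcd u u' w w' hu.sol hw.sol
    (fun s hs => hu.lower_of_mem_Icc hα hη (le_max_left _ _) (min_le_left _ _) hs)
    (fun s hs => hw.lower_of_mem_Icc hα hη (le_max_right _ _) (min_le_right _ _) hs) _
    (hzero hu.left hw.left ⟨by linarith, by linarith⟩ ⟨by linarith, by linarith⟩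
      (by simp [mem_uIcc, le_total]) ha)
    (hzero hu.right hw.right ⟨by linarith, by linarith⟩ ⟨by linarith, by linarith⟩
      (by simp [mem_uIcc, le_total]) hb) _ _
    (by linarith [le_max_left a a']) (by linarith [min_le_left b b']) s hs

lemma abs_position_and_action_of_moved_zero_le (h : IsNormalized g g' p M α K) {w w' : ℝ → ℝ}
    (hw : IsSecondOrderSol (force g p) w w') {a a' δ v V C : ℝ} (ha : |a' - a| ≤ δ)
    (hwa : w a' = 0) (hv : |v| ≤ V) (hV : ∀ s ∈ uIcc a a', |w' s| ≤ V)
    (hva : |w' a - v| ≤ C * δ) :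
    |w a + v * (a' - a)| ≤ (2 * M + C) * δ ^ 2 ∧
      |action g p w w' a a' - v ^ 2 / 2 * (a' - a)| ≤ (4 * M + C) * V * δ ^ 2 := by
  have hM := h.bound_pos
  have hδ : 0 ≤ δ := (abs_nonneg _).trans ha
  have hV₀ : 0 ≤ V := (abs_nonneg _).trans hv
  have hvel (s : ℝ) (hs : s ∈ uIcc a a') : |w' s - v| ≤ (2 * M + C) * δ := by
    have hsa := mul_le_mul_of_nonneg_left ((abs_sub_left_of_mem_uIcc hs).trans ha)
      (by positivity : 0 ≤ 2 * M)
    linarith [h.abs_deriv_sub_le hw a s, abs_sub_le (w' s) (w' a) v]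
  have hvel₀ : 0 ≤ (2 * M + C) * δ := (abs_nonneg _).trans (hvel a left_mem_uIcc)
  constructor
  · have := abs_sub_le_of_abs_deriv_le (f := fun s => w s - v * s) (f' := fun s => w' s - v * 1)
      (convex_uIcc a a') (fun s _ => (hw s).1.sub ((hasDerivAt_id s).const_mul v))
      (by simpa only [mul_one] using hvel) right_mem_uIcc left_mem_uIcc
    calc |w a + v * (a' - a)| = |w a - v * a - (w a' - v * a')| := by rw [hwa]; ring_nf
      _ ≤ (2 * M + C) * δ * |a - a'| := this
      _ ≤ (2 * M + C) * δ * δ := by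
        rw [abs_sub_comm]
        exact mul_le_mul_of_nonneg_left ha hvel₀
      _ = (2 * M + C) * δ ^ 2 := by ring
  · calc |action g p w w' a a' - v ^ 2 / 2 * (a' - a)|
        ≤ ((2 * M + C) * δ * V + 2 * M * V * |a' - a|) * |a' - a| :=
          h.abs_action_sub_mul_le hw hwa hv hV hvel
      _ ≤ ((2 * M + C) * δ * V + 2 * M * V * δ) * δ := by gcongr
      _ = (4 * M + C) * V * δ ^ 2 := by ring

lemma abs_action_sub_action_of_moved_zeros_le (h : IsNormalized g g' p M α K)
    {u u' w w' : ℝ → ℝ} (hu : IsSecondOrderSol (force g p) u u')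
    (hw : IsSecondOrderSol (force g p) w w') {a b a' b' e f δ V C : ℝ} (hab : a ≤ b)
    (ha : |a' - a| ≤ δ) (hb : |b' - b| ≤ δ) (hua : u a = 0) (hub : u b = 0) (hwa : w a' = 0)
    (hwb : w b' = 0) (hIa : uIcc a a' ⊆ Icc e f) (hIb : uIcc b b' ⊆ Icc e f)
    (huV : ∀ s ∈ Icc e f, |u' s| ≤ V) (hwV : ∀ s ∈ Icc e f, |w' s| ≤ V)
    (hclose : ∀ s ∈ Icc e f, |w s - u s| ≤ C * δ ∧ |w' s - u' s| ≤ C * δ) :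
    |action g p w w' a' b' - action g p u u' a b
        - (u' a ^ 2 / 2 * (a' - a) - u' b ^ 2 / 2 * (b' - b))|
      ≤ ((1 + K) * C ^ 2 * (b - a) + 2 * (V * (2 * M + C)) + 2 * ((4 * M + C) * V)) * δ ^ 2 := by
  have hma := hIa left_mem_uIcc
  have hmb := hIb left_mem_uIcc
  obtain ⟨hposa, hacta⟩ := h.abs_position_and_action_of_moved_zero_le hw ha hwa (huV a hma)
    (fun s hs => hwV s (hIa hs)) (hclose a hma).2
  obtain ⟨hposb, hactb⟩ := h.abs_position_and_action_of_moved_zero_le hw hb hwb (huV b hmb)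
    (fun s hs => hwV s (hIb hs)) (hclose b hmb).2
  have hvar := h.abs_action_sub_action_le hu hw hab
    fun s hs => hclose s (Icc_subset_Icc hma.1 hmb.2 hs)
  rw [hua, hub, sub_zero, sub_zero] at hvar
  have hsplit : action g p w w' a' b' = action g p w w' a b - action g p w w' a a'
      + action g p w w' b b' := by
    linarith [h.action_add_action hw a a' b', h.action_add_action hw a b b']
  have hmul {x y : ℝ} (hx : |x| ≤ V) (hy : |y| ≤ (2 * M + C) * δ ^ 2) :
      |x * y| ≤ V * ((2 * M + C) * δ ^ 2) := by
    rw [abs_mul]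
    exact mul_le_mul hx hy (abs_nonneg _) ((abs_nonneg _).trans hx)
  obtain ⟨h₁, h₁'⟩ := abs_le.mp (hmul (huV a hma) hposa)
  obtain ⟨h₂, h₂'⟩ := abs_le.mp (hmul (huV b hmb) hposb)
  obtain ⟨h₃, h₃'⟩ := abs_le.mp hacta
  obtain ⟨h₄, h₄'⟩ := abs_le.mp hactb
  obtain ⟨h₅, h₅'⟩ := abs_le.mp hvar
  rw [hsplit]
  exact abs_le.mpr ⟨by linarith, by linarith⟩

theorem exists_action_expansion (h : IsNormalized g g' p M α K) :
    ∃ τ > 0, ∀ η ≤ α / 8, ∀ a b, τ < b - a → ∃ C, ∃ δ₀ > 0,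
      ∀ a' b' δ, |a' - a| ≤ δ → |b' - b| ≤ δ → δ ≤ δ₀ →
        ∀ u u' w w', IsArc (force g p) α η a b u u' → IsArc (force g p) α η a' b' w w' →
          |action g p w w' a' b' - action g p u u' a b
            - (u' a ^ 2 / 2 * (a' - a) - u' b ^ 2 / 2 * (b' - b))| ≤ C * δ ^ 2 := by
  obtain ⟨τ, hτ, hclose⟩ := h.exists_arc_close
  refine ⟨τ, hτ, fun η hη a b hab => ?_⟩
  obtain ⟨C, δ₀, hδ₀, hδ₁, hclose⟩ := hclose η hη a b hab
  obtain ⟨V, hV⟩ : ∃ V, V = (α + 2 * M) * (b + 1 - (a - 1)) := ⟨_, rfl⟩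
  refine ⟨(1 + K) * C ^ 2 * (b - a) + 2 * (V * (2 * M + C)) + 2 * ((4 * M + C) * V), δ₀, hδ₀,
    fun a' b' δ ha hb hδ u u' w w' hu hw => ?_⟩
  obtain ⟨hab', hclose⟩ := hclose a' b' δ ha hb hδ
  obtain ⟨ha₁, ha₂⟩ := abs_le.mp (ha.trans (hδ.trans hδ₁))
  obtain ⟨hb₁, hb₂⟩ := abs_le.mp (hb.trans (hδ.trans hδ₁))
  exact h.abs_action_sub_action_of_moved_zeros_le hu.sol hw.sol (e := a - 1) (f := b + 1)
    (by linarith) ha hb hu.left hu.right hw.left hw.right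
    (uIcc_subset_Icc ⟨by linarith, by linarith⟩ ⟨by linarith, by linarith⟩)
    (uIcc_subset_Icc ⟨by linarith, by linarith⟩ ⟨by linarith, by linarith⟩)
    (fun s hs => hV ▸ h.abs_arc_deriv_le hη hu (by linarith) (by linarith) (by linarith) hs)
    (fun s hs => hV ▸ h.abs_arc_deriv_le hη hw hab' (by linarith) (by linarith) hs)
    (hclose u u' w w' hu hw)

end IsNormalized

namespace IsArc

variable {F : ℝ → ℝ → ℝ} {u u' : ℝ → ℝ} {α η a b s : ℝ}

lemma mono (h : IsArc F α η a b u u') (hab : a ≤ b) {η' : ℝ} (hη : η ≤ η') :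
    IsArc F α η' a b u u' :=
  ⟨h.sol, h.left, h.right, fun s hs =>
    (h.deriv_le s hs).trans (mul_le_mul_of_nonneg_right hη (sub_nonneg.mpr hab))⟩

lemma nonneg (h : IsArc F α η a b u u') (hα : 0 < α) (hη : η ≤ α / 8) (hs : s ∈ Icc a b) :
    0 ≤ u s := by
  refine le_trans ?_ (h.lower hα hη hs)
  have hmin : 0 ≤ min (s - a) (b - s) := le_min (sub_nonneg.mpr hs.1) (sub_nonneg.mpr hs.2)
  have hab : 0 ≤ b - a := by linarith [hs.1, hs.2]
  positivity

lemma le_mul_sq (h : IsArc F α η a b u u') (hα : 0 < α) (hη : η ≤ α / 8) (hs : s ∈ Icc a b) :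
    u s ≤ α * (b - a) ^ 2 := by
  have hab : 0 ≤ b - a := by linarith [hs.1, hs.2]
  have hle := abs_sub_le_of_abs_deriv_le (convex_Icc a b) (fun t _ => (h.sol t).1)
    (fun t ht => h.abs_deriv_le hα hη ht) (left_mem_Icc.mpr (hs.1.trans hs.2)) hs
  rw [h.left, sub_zero, abs_of_nonneg (sub_nonneg.mpr hs.1)] at hle
  calc u s ≤ α * (b - a) * (s - a) := (le_abs_self _).trans hle
    _ ≤ α * (b - a) * (b - a) := by gcongr; exact hs.2
    _ = α * (b - a) ^ 2 := by ring

lemma deriv_left_pos (h : IsArc F α η a b u u') (hα : 0 < α) (hη : η ≤ α / 8) (hab : a < b) :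
    0 < u' a := by
  have hlo := (abs_le.mp (h.deriv_le a (left_mem_Icc.mpr hab.le))).1
  have hηab := mul_le_mul_of_nonneg_right hη (sub_nonneg.mpr hab.le)
  have := mul_pos hα (sub_pos.mpr hab)
  linarith

lemma deriv_right_neg (h : IsArc F α η a b u u') (hα : 0 < α) (hη : η ≤ α / 8) (hab : a < b) :
    u' b < 0 := by
  have hhi := (abs_le.mp (h.deriv_le b (right_mem_Icc.mpr hab.le))).2
  have hηab := mul_le_mul_of_nonneg_right hη (sub_nonneg.mpr hab.le)
  have := mul_pos hα (sub_pos.mpr hab)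
  linarith

lemma abs_kinetic_sub_le (h : IsArc F α η a b u u') (hα : 0 < α) (hη : η ≤ α / 8)
    (hs : s ∈ Icc a b) :
    |u' s ^ 2 / 2 - (α * ((a + b) / 2 - s)) ^ 2 / 2| ≤ η * α * (b - a) ^ 2 := by
  have hab : 0 ≤ b - a := by linarith [hs.1, hs.2]
  have hpar : |α * ((a + b) / 2 - s)| ≤ α * (b - a) := by
    rw [abs_mul, abs_of_pos hα]
    exact mul_le_mul_of_nonneg_left (abs_le.mpr ⟨by linarith [hs.2], by linarith [hs.1]⟩) hα.le
  have hsum : |(u' s + α * ((a + b) / 2 - s)) / 2| ≤ α * (b - a) := by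
    rw [abs_div, abs_two]
    linarith [abs_add_le (u' s) (α * ((a + b) / 2 - s)), h.abs_deriv_le hα hη hs]
  calc |u' s ^ 2 / 2 - (α * ((a + b) / 2 - s)) ^ 2 / 2|
      = |u' s - α * ((a + b) / 2 - s)| * |(u' s + α * ((a + b) / 2 - s)) / 2| := by
        rw [← abs_mul]; ring_nf
    _ ≤ η * (b - a) * (α * (b - a)) :=
        mul_le_mul (h.deriv_le s hs) hsum (abs_nonneg _) ((abs_nonneg _).trans (h.deriv_le s hs))
    _ = η * α * (b - a) ^ 2 := by ring

end IsArc

lemma integral_sq_parabola_deriv (α a b : ℝ) :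
    ∫ s in a..b, (α * ((a + b) / 2 - s)) ^ 2 / 2 = α ^ 2 / 24 * (b - a) ^ 3 := by
  have hder (s : ℝ) : HasDerivAt (fun s => -(α ^ 2 / 6 * ((a + b) / 2 - s) ^ 3))
      ((α * ((a + b) / 2 - s)) ^ 2 / 2) s := by
    refine ((((hasDerivAt_id s).const_sub ((a + b) / 2)).pow 3).const_mul
      (α ^ 2 / 6)).neg.congr_deriv ?_
    norm_num
    ring
  rw [intervalIntegral.integral_eq_sub_of_hasDerivAt (fun s _ => hder s)
    (by apply Continuous.intervalIntegrable; fun_prop)]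
  ring

/-- The virial `x g(x) - G(x)`, where `G` is the potential of `g`. -/
noncomputable def virial (g : ℝ → ℝ) (x : ℝ) : ℝ := x * g x - potential g x

lemma virial_eq_integral {g : ℝ → ℝ} (hg : Continuous g) (x : ℝ) :
    virial g x = ∫ r in (0 : ℝ)..x, (g x - g r) := by
  rw [intervalIntegral.integral_sub (by simp) (hg.intervalIntegrable _ _),
    intervalIntegral.integral_const, smul_eq_mul, sub_zero, virial, potential]

lemma continuous_virial {g : ℝ → ℝ} (hg : Continuous g) : Continuous (virial g) :=
  (continuous_id.mul hg).sub (continuous_potential hg)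

namespace IsNormalized

variable {g g' p : ℝ → ℝ} {M α η a b s : ℝ} {K : NNReal} {u u' : ℝ → ℝ}

lemma virial_nonneg (h : IsNormalized g g' p M α K) {x : ℝ} (hx : 0 ≤ x) : 0 ≤ virial g x := by
  rw [virial_eq_integral h.continuous]
  exact intervalIntegral.integral_nonneg hx fun r hr => sub_nonneg.mpr (h.mono hr.2)

lemma exists_virial_le (h : IsNormalized g g' p M α K) {ε : ℝ} (hε : 0 < ε) :
    ∃ R > 0, ∀ x, 0 ≤ x → virial g x ≤ 2 * M * R + ε * x := by
  obtain ⟨R, hR, hRg⟩ := h.exists_deficit_le hε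
  have hM := h.bound_pos
  refine ⟨R, hR, fun x hx => ?_⟩
  have hint (a b : ℝ) : IntervalIntegrable (fun r => g x - g r) MeasureTheory.volume a b :=
    (continuous_const.sub h.continuous).intervalIntegrable a b
  have hle {a b B : ℝ} (hab : a ≤ b) (hB : ∀ r ∈ Icc a b, α - g r ≤ B) :
      ∫ r in a..b, (g x - g r) ≤ B * (b - a) := by
    have := intervalIntegral.integral_mono_on (g := fun _ => B) hab (hint a b) (by simp)
      fun r hr => by linarith [h.le_lim x, hB r hr]
    rwa [intervalIntegral.integral_const, smul_eq_mul, mul_comm] at this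
  rw [virial_eq_integral h.continuous]
  rcases le_total x R with hxR | hRx
  · calc ∫ r in (0 : ℝ)..x, (g x - g r) ≤ 2 * M * (x - 0) := hle hx fun r _ => h.deficit_le r
      _ ≤ 2 * M * R := by gcongr; linarith
      _ ≤ 2 * M * R + ε * x := le_add_of_nonneg_right (by positivity)
  · rw [← intervalIntegral.integral_add_adjacent_intervals (hint 0 R) (hint R x)]
    have hnear := hle hR.le fun r _ => h.deficit_le r
    have hfar := hle hRx fun r hr => hRg r hr.1
    have : 0 ≤ ε * R := by positivity
    linarith

/-- Multiply the equation by `u` and integrate by parts. -/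
lemma action_eq_integral_virial (h : IsNormalized g g' p M α K)
    (hu : IsSecondOrderSol (force g p) u u') (ha : u a = 0) (hb : u b = 0) :
    action g p u u' a b = ∫ s in a..b, (virial g (u s) - u' s ^ 2 / 2) := by
  have hprod : Continuous fun s => u' s * u' s + u s * force g p s (u s) :=
    (hu.continuous_deriv.mul hu.continuous_deriv).add
      (hu.continuous.mul (h.continuous_force_comp hu.continuous))
  have hparts := intervalIntegral.integral_eq_sub_of_hasDerivAt (a := a) (b := b)
    (fun s _ => (hu s).1.mul (hu s).2) (hprod.intervalIntegrable _ _)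
  simp only [Pi.mul_apply, ha, hb, zero_mul, sub_zero] at hparts
  calc action g p u u' a b
      = ∫ s in a..b,
          (lagrangian g p u u' s - (u' s * u' s + u s * force g p s (u s))) := by
        rw [intervalIntegral.integral_sub ((h.continuous_lagrangian hu).intervalIntegrable _ _)
          (hprod.intervalIntegrable _ _), hparts, sub_zero, action]
    _ = ∫ s in a..b, (virial g (u s) - u' s ^ 2 / 2) := by
        refine intervalIntegral.integral_congr fun s _ => ?_
        simp only [lagrangian, virial]
        ring

lemma action_add_cubic_eq_integral (h : IsNormalized g g' p M α K)
    (hu : IsArc (force g p) α η a b u u') :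
    action g p u u' a b + α ^ 2 / 24 * (b - a) ^ 3 = ∫ s in a..b,
      (virial g (u s) - (u' s ^ 2 / 2 - (α * ((a + b) / 2 - s)) ^ 2 / 2)) := by
  have hkin := hu.sol.continuous_deriv
  have hvir := (continuous_virial h.continuous).comp hu.sol.continuous
  rw [h.action_eq_integral_virial hu.sol hu.left hu.right, ← integral_sq_parabola_deriv,
    ← intervalIntegral.integral_add (f := fun s => virial g (u s) - u' s ^ 2 / 2)
      ((hvir.sub (by fun_prop)).intervalIntegrable _ _)
      (by apply Continuous.intervalIntegrable; fun_prop)]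
  exact intervalIntegral.integral_congr fun s _ => by ring

theorem exists_action_estimate (h : IsNormalized g g' p M α K) {ε : ℝ} (hε : 0 < ε) :
    ∃ η > 0, η ≤ α / 8 ∧ ∃ τ > 0, ∀ a b, τ ≤ b - a → ∀ u u', IsArc (force g p) α η a b u u' →
      |-action g p u u' a b - α ^ 2 / 24 * (b - a) ^ 3| ≤ ε * (b - a) ^ 3 := by
  have hα := h.pos
  have hM := h.bound_pos
  obtain ⟨R, hR, hvir⟩ := h.exists_virial_le (ε := ε / (3 * α)) (by positivity)
  obtain ⟨η, hη⟩ : ∃ η, η = min (α / 8) (ε / (3 * α)) := ⟨_, rfl⟩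
  have hηα : η ≤ α / 8 := hη ▸ min_le_left _ _
  have hηε : η * α ≤ ε / 3 := by
    calc η * α ≤ ε / (3 * α) * α := by gcongr; exact hη ▸ min_le_right _ _
      _ = ε / 3 := by field_simp
  refine ⟨η, hη ▸ by positivity, hηα, 1 + 6 * M * R / ε, by positivity, fun a b hab u u' hu => ?_⟩
  have hquot : 0 < 6 * M * R / ε := by positivity
  have hlong : 6 * M * R ≤ ε * (b - a) ^ 2 := by
    rw [← div_le_iff₀' hε]
    nlinarith
  have hlt : a < b := by linarith
  have hbound (s : ℝ) (hs : s ∈ uIoc a b) :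
      ‖virial g (u s) - (u' s ^ 2 / 2 - (α * ((a + b) / 2 - s)) ^ 2 / 2)‖ ≤ ε * (b - a) ^ 2 := by
    rw [uIoc_of_le hlt.le] at hs
    have hs' := Ioc_subset_Icc_self hs
    have hu₀ := hu.nonneg hα hηα hs'
    have hv₀ := h.virial_nonneg hu₀
    have hv₁ : virial g (u s) ≤ 2 * M * R + ε / 3 * (b - a) ^ 2 :=
      calc virial g (u s) ≤ 2 * M * R + ε / (3 * α) * (α * (b - a) ^ 2) :=
            (hvir _ hu₀).trans (by gcongr; exact hu.le_mul_sq hα hηα hs')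
        _ = 2 * M * R + ε / 3 * (b - a) ^ 2 := by field_simp
    obtain ⟨hlo, hhi⟩ := abs_le.mp ((hu.abs_kinetic_sub_le hα hηα hs').trans
      (mul_le_mul_of_nonneg_right hηε (sq_nonneg (b - a))))
    exact abs_le.mpr ⟨by linarith, by linarith⟩
  have := intervalIntegral.norm_integral_le_of_norm_le_const hbound
  rw [← h.action_add_cubic_eq_integral hu, Real.norm_eq_abs, abs_of_pos (sub_pos.mpr hlt)] at this
  rw [abs_sub_comm, sub_neg_eq_add, add_comm]
  exact this.trans_eq (by ring)

end IsNormalized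

/-- A choice `U a b`, with derivative `U' a b`, of an arc on each interval `[a, b]` of length at
least `τ`. Minus its action is almost `α² (b - a)³ / 24`, and its partial derivatives in `b` and `a`
are `± 1/2` times the squares of the slopes of the arc at these endpoints. -/
structure IsArcFamily (g p : ℝ → ℝ) (α ε τ : ℝ) (U U' : ℝ → ℝ → ℝ → ℝ) : Prop where
  isArc : ∀ a b, τ ≤ b - a → IsArc (force g p) α (α / 8) a b (U a b) (U' a b)
  abs_sub_le : ∀ a b, τ ≤ b - a →
    |-action g p (U a b) (U' a b) a b - α ^ 2 / 24 * (b - a) ^ 3| ≤ ε * (b - a) ^ 3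
  hasFDerivWithinAt : ∀ a b, τ ≤ b - a →
    HasFDerivWithinAt (fun q : ℝ × ℝ => -action g p (U q.1 q.2) (U' q.1 q.2) q.1 q.2)
      ((U' a b b ^ 2 / 2) • ContinuousLinearMap.snd ℝ ℝ ℝ
        - (U' a b a ^ 2 / 2) • ContinuousLinearMap.fst ℝ ℝ ℝ) {q | τ ≤ q.2 - q.1} (a, b)

namespace IsArcFamily

variable {g p : ℝ → ℝ} {α ε τ a b : ℝ} {U U' : ℝ → ℝ → ℝ → ℝ}

lemma continuousOn (h : IsArcFamily g p α ε τ U U') :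
    ContinuousOn (fun q : ℝ × ℝ => -action g p (U q.1 q.2) (U' q.1 q.2) q.1 q.2)
      {q | τ ≤ q.2 - q.1} :=
  fun q hq => (h.hasFDerivWithinAt q.1 q.2 hq).continuousWithinAt

lemma hasFDerivAt (h : IsArcFamily g p α ε τ U U') (hab : τ < b - a) :
    HasFDerivAt (fun q : ℝ × ℝ => -action g p (U q.1 q.2) (U' q.1 q.2) q.1 q.2)
      ((U' a b b ^ 2 / 2) • ContinuousLinearMap.snd ℝ ℝ ℝ
        - (U' a b a ^ 2 / 2) • ContinuousLinearMap.fst ℝ ℝ ℝ) (a, b) :=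
  (h.hasFDerivWithinAt a b hab.le).hasFDerivAt <| mem_of_superset
    ((isOpen_lt continuous_const (continuous_snd.sub continuous_fst)).mem_nhds hab)
    fun q (hq : τ < q.2 - q.1) => hq.le

lemma hasDerivAt_right (h : IsArcFamily g p α ε τ U U') (hab : τ < b - a) :
    HasDerivAt (fun s => -action g p (U a s) (U' a s) a s) (U' a b b ^ 2 / 2) b := by
  simpa [Function.comp_def] using
    (h.hasFDerivAt hab).comp_hasDerivAt b ((hasDerivAt_const b a).prodMk (hasDerivAt_id b))

lemma hasDerivAt_left (h : IsArcFamily g p α ε τ U U') (hab : τ < b - a) :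
    HasDerivAt (fun s => -action g p (U s b) (U' s b) s b) (-(U' a b a ^ 2 / 2)) a := by
  simpa [Function.comp_def] using
    (h.hasFDerivAt hab).comp_hasDerivAt a ((hasDerivAt_id a).prodMk (hasDerivAt_const a b))

end IsArcFamily

lemma hasFDerivWithinAt_of_norm_sub_le_sq {E F : Type*} [NormedAddCommGroup E] [NormedSpace ℝ E]
    [NormedAddCommGroup F] [NormedSpace ℝ F] {f : E → F} {f' : E →L[ℝ] F} {S : Set E} {x : E}
    {C : ℝ} (h : ∀ᶠ y in 𝓝[S] x, ‖f y - f x - f' (y - x)‖ ≤ C * ‖y - x‖ ^ 2) :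
    HasFDerivWithinAt f f' S x := by
  refine .of_isLittleO ((Asymptotics.IsBigO.of_bound C ?_).trans_isLittleO
    ((Asymptotics.isLittleO_pow_sub_sub x one_lt_two).mono nhdsWithin_le_nhds))
  simpa using h

theorem IsNormalized.exists_isArcFamily {g g' p : ℝ → ℝ} {M α : ℝ} {K : NNReal}
    (h : IsNormalized g g' p M α K) {ε : ℝ} (hε : 0 < ε) :
    ∃ τ > 0, ∃ U U', IsArcFamily g p α ε τ U U' := by
  obtain ⟨η, hη, hηα, τ₁, hτ₁, hest⟩ := h.exists_action_estimate hε
  obtain ⟨τ₂, hτ₂, hex⟩ := h.exists_isArc hη hηα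
  obtain ⟨τ₃, hτ₃, hexp⟩ := h.exists_action_expansion
  choose! U U' hU using hex
  refine ⟨τ₁ + τ₂ + τ₃, by positivity, U, U',
    fun a b hab => (hU a b (by linarith)).mono (by linarith) hηα,
    fun a b hab => hest a b (by linarith) _ _ (hU a b (by linarith)), fun a b hab => ?_⟩
  obtain ⟨C, δ₀, hδ₀, hC⟩ := hexp η hηα a b (by linarith)
  refine hasFDerivWithinAt_of_norm_sub_le_sq (C := C) ?_
  filter_upwards [self_mem_nhdsWithin,
    mem_nhdsWithin_of_mem_nhds (Metric.closedBall_mem_nhds (a, b) hδ₀)] with q hq hqδ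
  have := hC q.1 q.2 ‖q - (a, b)‖ (norm_fst_le (q - (a, b))) (norm_snd_le (q - (a, b)))
    (by rwa [← dist_eq_norm]) _ _ _ _ (hU a b (by linarith))
    (hU q.1 q.2 (by linarith [show τ₁ + τ₂ + τ₃ ≤ q.2 - q.1 from hq]))
  rw [← abs_neg] at this
  refine (le_of_eq ?_).trans this
  rw [Real.norm_eq_abs]
  congr 1
  simp only [sub_neg_eq_add, sub_apply, smul_apply, ContinuousLinearMap.coe_snd', Prod.snd_sub,
    smul_eq_mul, ContinuousLinearMap.coe_fst', Prod.fst_sub, neg_sub]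
  ring

/-- The sign `1` for `false` and `-1` for `true`, which distinguishes arcs above the axis from arcs
below it. -/
def boolSign (e : Bool) : ℝ := cond e (-1) 1

lemma boolSign_mul_boolSign_mul (e : Bool) (x : ℝ) : boolSign e * (boolSign e * x) = x := by
  cases e <;> simp [boolSign]

lemma boolSign_not (e : Bool) : boolSign (!e) = -boolSign e := by
  cases e <;> simp [boolSign]

lemma abs_boolSign_mul (e : Bool) (x : ℝ) : |boolSign e * x| = |x| := by
  cases e <;> simp [boolSign]

/-- The function `g`, reflected through the origin if `e` is `true`: arcs below the axis are the
negatives of arcs for the reflected equation. -/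
def reflect (e : Bool) (g : ℝ → ℝ) (x : ℝ) : ℝ := boolSign e * g (boolSign e * x)

lemma reflect_false (g : ℝ → ℝ) : reflect false g = g := by
  ext x
  simp [reflect, boolSign]

/-- The equation `ü + g(u) = p(t)` and its reflection `ü - g(-u) = -p(t)` are both normalised. -/
def IsBiNormalized (g g' p : ℝ → ℝ) (M : ℝ) (α : Bool → ℝ) (K : NNReal) : Prop :=
  ∀ e, IsNormalized (reflect e g) (fun x => g' (boolSign e * x)) (fun t => boolSign e * p t) M (α e)
    K

lemma IsBiNormalized.isNormalized {g g' p : ℝ → ℝ} {M : ℝ} {α : Bool → ℝ} {K : NNReal}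
    (h : IsBiNormalized g g' p M α K) : IsNormalized g g' p M (α false) K := by
  simpa [reflect_false, boolSign] using h false

lemma IsSecondOrderSol.of_reflect {g p u u' : ℝ → ℝ} {e : Bool}
    (h : IsSecondOrderSol (force (reflect e g) fun t => boolSign e * p t) u u') :
    IsSecondOrderSol (force g p) (fun t => boolSign e * u t) fun t => boolSign e * u' t := fun t =>
  ⟨(h t).1.const_mul _, ((h t).2.const_mul _).congr_deriv (by
    rw [force, reflect, mul_sub, boolSign_mul_boolSign_mul, boolSign_mul_boolSign_mul])⟩

/-- A solution of `ü + g(u) = p(t)` which consists of arcs on the intervals `[t k, t (k + 1)]`,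
`k < n`, alternately above and below the axis; the lengths of the intervals are in `(τ, σ]`. -/
structure IsArcChain (g p : ℝ → ℝ) (α : Bool → ℝ) (τ σ : ℝ) (n : ℕ) (t : ℕ → ℝ)
    (v v' : ℝ → ℝ) : Prop where
  sol : IsSecondOrderSol (force g p) v v'
  pos : 0 < n
  gap : ∀ k < n, t (k + 1) - t k ∈ Ioc τ σ
  isArc : ∀ k < n, IsArc (force (reflect k.bodd g) fun t => boolSign k.bodd * p t) (α k.bodd)
    (α k.bodd / 8) (t k) (t (k + 1)) (fun s => boolSign k.bodd * v s)
    fun s => boolSign k.bodd * v' s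

lemma exists_mem_Icc_of_mem_Icc {t : ℕ → ℝ} {s : ℝ} {n : ℕ} (hn : 0 < n)
    (hs : s ∈ Icc (t 0) (t n)) : ∃ k < n, s ∈ Icc (t k) (t (k + 1)) := by
  induction n, hn using Nat.le_induction with
  | base => exact ⟨0, zero_lt_one, hs⟩
  | succ n _ ih =>
    rcases le_total s (t n) with h | h
    · obtain ⟨k, hk, hks⟩ := ih ⟨hs.1, h⟩
      exact ⟨k, hk.trans n.lt_succ_self, hks⟩
    · exact ⟨n, n.lt_succ_self, h, hs.2⟩

/-- `v` takes a value `≥ H` and a value `≤ -H` on every interval of length `W` contained in `S`. -/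
def OscillatesOn (H W : ℝ) (v : ℝ → ℝ) (S : Set ℝ) : Prop :=
  ∀ s, Icc s (s + W) ⊆ S →
    (∃ t ∈ Icc s (s + W), H ≤ v t) ∧ ∃ t ∈ Icc s (s + W), v t ≤ -H

namespace IsArcChain

variable {g p : ℝ → ℝ} {α : Bool → ℝ} {τ σ A : ℝ} {n : ℕ} {t : ℕ → ℝ} {v v' : ℝ → ℝ}

lemma abs_le (h : IsArcChain g p α τ σ n t v v') (hα : ∀ e, 0 < α e) (hA : ∀ e, α e ≤ A)
    (hτ : 0 ≤ τ) {s : ℝ} (hs : s ∈ Icc (t 0) (t n)) : |v s| ≤ A * σ ^ 2 ∧ |v' s| ≤ A * σ := by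
  obtain ⟨k, hk, hks⟩ := exists_mem_Icc_of_mem_Icc h.pos hs
  obtain ⟨hgap, hgap'⟩ := h.gap k hk
  have hA₀ : 0 ≤ A := (hα false).le.trans (hA false)
  have hlen : 0 ≤ t (k + 1) - t k := hτ.trans hgap.le
  rw [← abs_boolSign_mul k.bodd (v s), ← abs_boolSign_mul k.bodd (v' s),
    abs_of_nonneg ((h.isArc k hk).nonneg (hα _) le_rfl hks)]
  exact ⟨((h.isArc k hk).le_mul_sq (hα _) le_rfl hks).trans (by gcongr; exact hA _),
    ((h.isArc k hk).abs_deriv_le (hα _) le_rfl hks).trans (by gcongr; exact hA _)⟩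

lemma exists_le (h : IsArcChain g p α τ σ n t v v') (hα : ∀ e, 0 < α e) (hA : ∀ e, A ≤ α e)
    (hτ : 0 ≤ τ) {k : ℕ} (hk : k < n) :
    ∃ m ∈ Icc (t k) (t (k + 1)), A / 16 * τ ^ 2 ≤ boolSign k.bodd * v m := by
  have hgap := (h.gap k hk).1
  have hα' := hα k.bodd
  have hmem : (t k + t (k + 1)) / 2 ∈ Icc (t k) (t (k + 1)) := ⟨by linarith, by linarith⟩
  refine ⟨_, hmem, le_trans ?_ ((h.isArc k hk).lower hα' le_rfl hmem)⟩
  calc A / 16 * τ ^ 2 ≤ α k.bodd / 16 * (t (k + 1) - t k) ^ 2 := by gcongr; exact hA _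
    _ = α k.bodd / 8 * (t (k + 1) - t k)
        * min ((t k + t (k + 1)) / 2 - t k) (t (k + 1) - (t k + t (k + 1)) / 2) := by
      rw [min_eq_left (by linarith)]
      ring

/-- A window of length `3 σ` contains two consecutive intervals of the chain. -/
lemma oscillatesOn (h : IsArcChain g p α τ σ n t v v') (hα : ∀ e, 0 < α e) (hA : ∀ e, A ≤ α e)
    (hτ : 0 ≤ τ) : OscillatesOn (A / 16 * τ ^ 2) (3 * σ) v (Icc (t 0) (t n)) := by
  intro s hs
  have hσ : 0 < σ := hτ.trans_lt ((h.gap 0 h.pos).1.trans_le (h.gap 0 h.pos).2)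
  have hW : s ≤ s + 3 * σ := by linarith
  have hend : s + 3 * σ ≤ t n := (hs (right_mem_Icc.mpr hW)).2
  obtain ⟨k, hk, hsk, hks⟩ := exists_mem_Icc_of_mem_Icc h.pos (hs (left_mem_Icc.mpr hW))
  have hgap₀ := (h.gap k hk).2
  have hk₁ : k + 1 < n := by
    refine (Nat.succ_le_of_lt hk).lt_of_ne fun hkn => ?_
    rw [← hkn] at hend
    linarith
  obtain ⟨hgap₁, hgap₁'⟩ : t (k + 2) - t (k + 1) ∈ Ioc τ σ := h.gap (k + 1) hk₁
  have hk₂ : k + 2 < n := by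
    refine (Nat.succ_le_of_lt hk₁).lt_of_ne fun hkn => ?_
    rw [← hkn] at hend
    linarith
  have hgap₂ := (h.gap (k + 2) hk₂).2
  obtain ⟨m₁, ⟨hm₁, hm₁'⟩, hv₁⟩ := h.exists_le hα hA hτ hk₁
  obtain ⟨m₂, ⟨hm₂, hm₂'⟩, hv₂⟩ := h.exists_le hα hA hτ hk₂
  have hmem₁ : m₁ ∈ Icc s (s + 3 * σ) := ⟨by linarith, by linarith⟩
  have hmem₂ : m₂ ∈ Icc s (s + 3 * σ) := ⟨by linarith, by linarith⟩
  rw [Nat.bodd_succ] at hv₁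
  rw [Nat.bodd_succ, Nat.bodd_succ, Bool.not_not] at hv₂
  cases hb : k.bodd
  · simp only [hb, boolSign, Bool.not_false, cond_true, cond_false, neg_mul, one_mul] at hv₁ hv₂
    exact ⟨⟨m₂, hmem₂, hv₂⟩, m₁, hmem₁, by linarith⟩
  · simp only [hb, boolSign, Bool.not_true, cond_true, cond_false, neg_mul, one_mul] at hv₁ hv₂
    exact ⟨⟨m₁, hmem₁, hv₁⟩, m₂, hmem₂, by linarith⟩

end IsArcChain

namespace IsBiNormalized

variable {g g' p : ℝ → ℝ} {M : ℝ} {α : Bool → ℝ} {K : NNReal}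

/-- Consecutive arcs lie on opposite sides of the axis, so their slopes at the common zero agree as
soon as the squares of these slopes do. -/
lemma exists_isArcChain_of_sq_deriv_eq (h : IsBiNormalized g g' p M α K) {τ σ : ℝ} {n : ℕ}
    {t : ℕ → ℝ} {U U' : ℕ → ℝ → ℝ} (hτ : 0 ≤ τ) (hn : 0 < n)
    (hgap : ∀ k < n, t (k + 1) - t k ∈ Ioc τ σ)
    (hU : ∀ k < n, IsArc (force (reflect k.bodd g) fun t => boolSign k.bodd * p t) (α k.bodd)
      (α k.bodd / 8) (t k) (t (k + 1)) (U k) (U' k))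
    (hsq : ∀ k, k + 1 < n → U' k (t (k + 1)) ^ 2 = U' (k + 1) (t (k + 1)) ^ 2) :
    ∃ v v', IsArcChain g p α τ σ n t v v' := by
  have hlt (k : ℕ) (hk : k < n) : t k < t (k + 1) := by linarith [(hgap k hk).1]
  have heq (k : ℕ) (hk : k < n) :
      ((fun s => boolSign k.bodd * U k s) = fun s => boolSign (Nat.bodd 0) * U 0 s) ∧
        (fun s => boolSign k.bodd * U' k s) = fun s => boolSign (Nat.bodd 0) * U' 0 s := by
    induction k with
    | zero => exact ⟨rfl, rfl⟩
    | succ k ih =>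
      have hk' := k.lt_succ_self.trans hk
      have hneg := (hU k hk').deriv_right_neg (h _).pos le_rfl (hlt k hk')
      have hpos := (hU (k + 1) hk).deriv_left_pos (h _).pos le_rfl (hlt (k + 1) hk)
      have hslope : U' (k + 1) (t (k + 1)) = -U' k (t (k + 1)) := by
        rw [← abs_of_pos hpos, ← abs_of_neg hneg]
        exact ((sq_eq_sq_iff_abs_eq_abs _ _).mp (hsq k hk)).symm
      obtain ⟨hu, hu'⟩ := (hU (k + 1) hk).sol.of_reflect.eq_of_eq_of_eq
        h.isNormalized.lipschitzWith_force (hU k hk').sol.of_reflect (t₀ := t (k + 1))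
        (by rw [(hU (k + 1) hk).left, (hU k hk').right, mul_zero, mul_zero])
        (by rw [hslope, Nat.bodd_succ, boolSign_not, neg_mul_neg])
      exact ⟨hu.trans (ih hk').1, hu'.trans (ih hk').2⟩
  refine ⟨_, _, (hU 0 hn).sol.of_reflect, hn, hgap, fun k hk => ?_⟩
  obtain ⟨hu, hu'⟩ := heq k hk
  simpa only [← congrFun hu, ← congrFun hu', boolSign_mul_boolSign_mul] using hU k hk

/-- The zeros are a critical point of the sum of the actions of the arcs, and criticality at an
interior zero means that the two slopes there have the same square. -/
theorem exists_isArcChain (h : IsBiNormalized g g' p M α K) (τ₀ : ℝ) :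
    ∃ τ > τ₀, ∃ σ > 0, ∀ a b, σ < b - a →
      ∃ n t v v', t 0 = a ∧ t n = b ∧ IsArcChain g p α τ σ n t v v' := by
  have hcoeff (e : Bool) : 0 < α e ^ 2 / 24 := by have := (h e).pos; positivity
  obtain ⟨ε, hε, Λ, hΛ, hcrit⟩ := exists_critical_subdivision
    (c₀ := min (α false ^ 2 / 24) (α true ^ 2 / 24)) (C := max (α false ^ 2 / 24) (α true ^ 2 / 24))
    (lt_min (hcoeff _) (hcoeff _)) ((min_le_left _ _).trans (le_max_left _ _))
  choose τ₁ hτ₁ U U' hU using fun e => (h e).exists_isArcFamily hε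
  obtain ⟨τ, hτ⟩ : ∃ τ, τ = τ₁ false + τ₁ true + |τ₀| := ⟨_, rfl⟩
  have hττ₁ (e : Bool) : τ₁ e ≤ τ := by
    cases e <;> linarith [hτ₁ false, hτ₁ true, abs_nonneg τ₀]
  have hτ_pos : 0 < τ := (hτ₁ false).trans_le (hττ₁ false)
  have hcost : IsApproxCubicCost (min (α false ^ 2 / 24) (α true ^ 2 / 24))
      (max (α false ^ 2 / 24) (α true ^ 2 / 24)) ε τ (fun k => α k.bodd ^ 2 / 24)
      fun k a b => -action (reflect k.bodd g) (fun t => boolSign k.bodd * p t)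
        (U k.bodd a b) (U' k.bodd a b) a b :=
    { coeff_mem := fun k => by cases k.bodd <;> simp
      periodic := fun k => by simp only [Nat.bodd_add, Nat.bodd_two, Bool.xor_false]
      abs_sub_le := fun k x y hxy => (hU _).abs_sub_le x y ((hττ₁ _).trans hxy)
      continuousOn := fun k => (hU _).continuousOn.mono fun q hq => (hττ₁ _).trans hq }
  refine ⟨τ, by linarith [hτ₁ false, hτ₁ true, le_abs_self τ₀], Λ * τ, mul_pos hΛ hτ_pos,
    fun a b hab => ?_⟩
  obtain ⟨n, t, ht₀, htn, hgap, hmin⟩ := hcrit _ _ τ hτ_pos hcost a b hab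
  have hn : 0 < n := by
    refine Nat.pos_of_ne_zero fun hn => ?_
    rw [hn, ht₀] at htn
    linarith [mul_pos hΛ hτ_pos]
  have hlong (k : ℕ) (hk : k < n) : τ₁ k.bodd < t (k + 1) - t k :=
    (hττ₁ _).trans_lt (hgap k hk).1
  obtain ⟨v, v', hv⟩ := h.exists_isArcChain_of_sq_deriv_eq hτ_pos.le hn hgap
    (U := fun k => U k.bodd (t k) (t (k + 1))) (U' := fun k => U' k.bodd (t k) (t (k + 1)))
    (fun k hk => (hU _).isArc _ _ (hlong k hk).le) fun k hk => by
      have := (hmin k hk).hasDerivAt_eq_zero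
        (((hU _).hasDerivAt_right (hlong k (k.lt_succ_self.trans hk))).add
          ((hU _).hasDerivAt_left (hlong (k + 1) hk)))
      linarith
  exact ⟨n, t, v, v', ht₀, htn, hv⟩

lemma exists_oscillatesOn_Icc (h : IsBiNormalized g g' p M α K) (N : ℝ) :
    ∃ H > N, ∃ B, ∃ W > 0, ∀ a b, W < b - a → ∃ v v', IsSecondOrderSol (force g p) v v' ∧
      (∀ s ∈ Icc a b, |v s| ≤ B ∧ |v' s| ≤ B) ∧ OscillatesOn H W v (Icc a b) := by
  obtain ⟨A, hA⟩ : ∃ A, A = min (α false) (α true) := ⟨_, rfl⟩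
  have hA_pos : 0 < A := hA ▸ lt_min (h _).pos (h _).pos
  have hA_le (e : Bool) : A ≤ α e := by cases e <;> simp [hA]
  have hle_max (e : Bool) : α e ≤ max (α false) (α true) := by cases e <;> simp
  obtain ⟨τ, hτ, σ, hσ, hchain⟩ := h.exists_isArcChain (1 + 16 * |N| / A)
  have hquot : 0 ≤ 16 * |N| / A := by positivity
  have hτ₀ : 0 ≤ τ := by linarith
  refine ⟨A / 16 * τ ^ 2, ?_, max (max (α false) (α true) * σ ^ 2) (max (α false) (α true) * σ),
    3 * σ, by positivity, fun a b hab => ?_⟩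
  · have : 16 * |N| / A < τ ^ 2 := by nlinarith
    rw [div_lt_iff₀ hA_pos] at this
    linarith [le_abs_self N]
  · obtain ⟨n, t, v, v', rfl, rfl, hv⟩ := hchain a b (by linarith)
    refine ⟨v, v', hv.sol, fun s hs => ?_, hv.oscillatesOn (fun e => (h e).pos) hA_le hτ₀⟩
    obtain ⟨hpos, hvel⟩ := hv.abs_le (fun e => (h e).pos) hle_max hτ₀ hs
    exact ⟨hpos.trans (le_max_left _ _), hvel.trans (le_max_right _ _)⟩

end IsBiNormalized

theorem IsSecondOrderSol.exists_subseq_tendsto {F : ℝ → ℝ → ℝ} {K : NNReal} {C B t₀ : ℝ}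
    (hF : ∀ t, LipschitzWith K (F t)) (hc : ∀ x, Continuous fun t => F t x)
    (hC : ∀ t x, |F t x| ≤ C) {v v' : ℕ → ℝ → ℝ} (hv : ∀ n, IsSecondOrderSol F (v n) (v' n))
    (hB : ∀ n, |v n t₀| ≤ B ∧ |v' n t₀| ≤ B) :
    ∃ w w', IsSecondOrderSol F w w' ∧ ∃ φ : ℕ → ℕ, StrictMono φ ∧
      ∀ R, ∀ δ > 0, ∀ᶠ n in atTop, ∀ t, |t - t₀| ≤ R →
        |v (φ n) t - w t| ≤ δ ∧ |v' (φ n) t - w' t| ≤ δ := by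
  obtain ⟨⟨x, y⟩, -, φ, hφ, hlim⟩ := (isCompact_Icc.prod isCompact_Icc).tendsto_subseq
    (x := fun n => (v n t₀, v' n t₀)) (s := Icc (-B) B ×ˢ Icc (-B) B)
    fun n => ⟨abs_le.mp (hB n).1, abs_le.mp (hB n).2⟩
  obtain ⟨w, w', hw, hw₀, hw'₀⟩ := exists_of_bounded hF hc hC t₀ x y
  refine ⟨w, w', hw, φ, hφ, fun R δ hδ => ?_⟩
  filter_upwards [Metric.tendsto_nhds.mp hlim (δ / Real.exp (max 1 K * R)) (by positivity)]
    with n hn t ht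
  simp only [Function.comp_apply, lt_div_iff₀ (Real.exp_pos _)] at hn
  have hexp : dist (v (φ n) t₀, v' (φ n) t₀) (x, y) * Real.exp (max 1 K * |t - t₀|) ≤ δ :=
    le_trans (by gcongr) hn.le
  have := (hv (φ n)).abs_sub_le hF hw (t₀ := t₀) (δ := dist (v (φ n) t₀, v' (φ n) t₀) (x, y))
    (by rw [hw₀, ← Real.dist_eq]; exact le_max_left _ _)
    (by rw [hw'₀, ← Real.dist_eq]; exact le_max_right _ _) t
  exact ⟨this.1.trans hexp, this.2.trans hexp⟩

lemma OscillatesOn.of_abs_sub_le {H δ W : ℝ} {v w : ℝ → ℝ} {S : Set ℝ}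
    (h : OscillatesOn H W v S) (hvw : ∀ t ∈ S, |v t - w t| ≤ δ) : OscillatesOn (H - δ) W w S := by
  intro s hs
  obtain ⟨⟨t₁, ht₁, hv₁⟩, t₂, ht₂, hv₂⟩ := h s hs
  exact ⟨⟨t₁, ht₁, by linarith [(abs_le.mp (hvw t₁ (hs ht₁))).2]⟩,
    t₂, ht₂, by linarith [(abs_le.mp (hvw t₂ (hs ht₂))).1]⟩

theorem IsBiNormalized.exists_oscillatesOn_univ {g g' p : ℝ → ℝ} {M : ℝ} {α : Bool → ℝ}
    {K : NNReal} (h : IsBiNormalized g g' p M α K) (N : ℝ) :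
    ∃ H > N, ∃ B W, ∃ v v', IsSecondOrderSol (force g p) v v' ∧
      (∀ s, |v s| ≤ B ∧ |v' s| ≤ B) ∧ OscillatesOn H W v univ := by
  obtain ⟨H, hH, B, W, hW, hex⟩ := h.exists_oscillatesOn_Icc (N + 1)
  choose v v' hv hB hosc using fun n : ℕ => hex (-(W + n)) (W + n) (by
    linarith [n.cast_nonneg (α := ℝ)])
  obtain ⟨w, w', hw, φ, hφ, hlim⟩ := IsSecondOrderSol.exists_subseq_tendsto (t₀ := 0)
    h.isNormalized.lipschitzWith_force h.isNormalized.continuous_force h.isNormalized.abs_force_le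
    hv fun n => hB n 0 ⟨by linarith [n.cast_nonneg (α := ℝ)], by linarith [n.cast_nonneg (α := ℝ)]⟩
  have hexhaust (R : ℝ) : ∀ᶠ n in atTop, ∀ t, |t| ≤ R → t ∈ Icc (-(W + φ n)) (W + φ n) := by
    filter_upwards [(tendsto_natCast_atTop_atTop.comp hφ.tendsto_atTop).eventually_ge_atTop R]
      with n hn t ht
    have : R ≤ φ n := hn
    exact abs_le.mp (by linarith)
  refine ⟨H - 1, by linarith, B + 1, W, w, w', hw, fun s => ?_, fun s _ => ?_⟩
  · obtain ⟨n, hmem, hclose⟩ := ((hexhaust |s|).and (hlim |s| 1 one_pos)).exists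
    obtain ⟨hpos, hvel⟩ := hclose s (by rw [sub_zero])
    obtain ⟨hBpos, hBvel⟩ := hB _ s (hmem s le_rfl)
    rw [abs_sub_comm] at hpos hvel
    exact ⟨by linarith [abs_sub_abs_le_abs_sub (w s) (v (φ n) s)],
      by linarith [abs_sub_abs_le_abs_sub (w' s) (v' (φ n) s)]⟩
  · have hwindow (t : ℝ) (ht : t ∈ Icc s (s + W)) : |t| ≤ |s| + W :=
      abs_le.mpr ⟨by linarith [neg_abs_le s, ht.1], by linarith [le_abs_self s, ht.2]⟩
    obtain ⟨n, hmem, hclose⟩ := ((hexhaust (|s| + W)).and (hlim (|s| + W) 1 one_pos)).exists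
    have hsub : Icc s (s + W) ⊆ Icc (-(W + φ n)) (W + φ n) := fun t ht => hmem t (hwindow t ht)
    have hosc' : OscillatesOn H W (v (φ n)) (Icc s (s + W)) :=
      fun r hr => hosc _ r (hr.trans hsub)
    exact hosc'.of_abs_sub_le (fun t ht => (hclose t (by
      rw [sub_zero]; exact hwindow t ht)).1) s Subset.rfl

lemma OscillatesOn.infinite_setOf_eq {H W : ℝ} {v : ℝ → ℝ} (h : OscillatesOn H W v univ)
    (hv : Continuous v) {y : ℝ} (hy : |y| ≤ H) : {t | v t = y}.Infinite := by
  refine Set.infinite_of_not_bddAbove fun ⟨b, hb⟩ => ?_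
  obtain ⟨⟨t₁, ht₁, hv₁⟩, t₂, ht₂, hv₂⟩ := h (b + 1) (subset_univ _)
  obtain ⟨t, ht, hty⟩ := intermediate_value_uIcc hv.continuousOn
    (mem_uIcc_of_le (hv₂.trans (abs_le.mp hy).1) ((abs_le.mp hy).2.trans hv₁))
  linarith [(uIcc_subset_Icc ht₂ ht₁ ht).1, show t ≤ b from hb hty]

lemma IsSecondOrderSol.isSolution {g p u u' : ℝ → ℝ} (hg : Continuous g) (hp : Continuous p)
    (h : IsSecondOrderSol (force g p) u u') : IsSolution g p u := by
  have hderiv : deriv u = u' := funext fun t => (h t).1.deriv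
  have hderiv' : deriv u' = fun t => p t - g (u t) := funext fun t => (h t).2.deriv
  have hu := h.continuous
  refine ⟨?_, fun t => by rw [hderiv, hderiv']; ring⟩
  rw [show (2 : WithTop ℕ∞) = 1 + 1 from rfl, contDiff_succ_iff_deriv, hderiv,
    contDiff_one_iff_deriv, hderiv']
  exact ⟨fun t => (h t).1.differentiableAt, by simp, fun t => (h t).2.differentiableAt,
    by fun_prop⟩

section Necessity

variable {g p u : ℝ → ℝ} {A : ℝ}

lemma IsSolution.isSecondOrderSol (h : IsSolution g p u) :
    IsSecondOrderSol (force g p) u (deriv u) := by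
  have hu := h.1
  rw [show (2 : WithTop ℕ∞) = 1 + 1 from rfl, contDiff_succ_iff_deriv,
    contDiff_one_iff_deriv] at hu
  exact fun t => ⟨(hu.1 t).hasDerivAt,
    (hu.2.2.1 t).hasDerivAt.congr_deriv (eq_sub_of_add_eq (h.2 t))⟩

lemma IsSecondOrderSol.abs_deriv_le_of_abs_le {F : ℝ → ℝ → ℝ} {u' : ℝ → ℝ} {B C : ℝ}
    (h : IsSecondOrderSol F u u') (hB : ∀ t, |u t| ≤ B) (hC : ∀ t, |F t (u t)| ≤ C) (t : ℝ) :
    |u' t| ≤ 2 * B + C := by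
  obtain ⟨ξ, hξ, hle⟩ := exists_abs_deriv_le_div (lt_add_one t) (fun s => (h s).1) (hB t)
    (hB (t + 1))
  have hdiff : |u' t - u' ξ| ≤ C * |t - ξ| := abs_sub_le_of_abs_deriv_le convex_univ
    (fun s _ => (h s).2) (fun s _ => hC s) (mem_univ ξ) (mem_univ t)
  have hξt : |t - ξ| ≤ 1 := abs_le.mpr ⟨by linarith [hξ.2], by linarith [hξ.1]⟩
  have hC₀ : 0 ≤ C := (abs_nonneg _).trans (hC 0)
  rw [add_sub_cancel_left, div_one] at hle
  calc |u' t| = |u' ξ + (u' t - u' ξ)| := by rw [add_sub_cancel]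
    _ ≤ |u' ξ| + |u' t - u' ξ| := abs_add_le _ _
    _ ≤ 2 * B + C := add_le_add hle (hdiff.trans (mul_le_of_le_one_right hC₀ hξt))

lemma HasAsymptoticAverage.mem_Icc_of_abs_integral_sub_le {f : ℝ → ℝ} {c d D : ℝ}
    (hA : HasAsymptoticAverage p A) (hf : Continuous f) (hcd : ∀ s, f s ∈ Icc c d)
    (hD : ∀ T, |(∫ s in (0 : ℝ)..T, p s) - ∫ s in (0 : ℝ)..T, f s| ≤ D) : A ∈ Icc c d := by
  have hmean : Tendsto (fun T : ℝ => (1 / T) * ∫ s in (0 : ℝ)..T, p s) atTop (𝓝 A) := by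
    simpa using hA.tendsto_at 0
  have herr : Tendsto (fun T : ℝ => D / T) atTop (𝓝 0) := tendsto_const_nhds.div_atTop tendsto_id
  have hint (T : ℝ) (hT : 0 ≤ T) : ∫ s in (0 : ℝ)..T, f s ∈ Icc (c * T) (d * T) := by
    have hfT : IntervalIntegrable f MeasureTheory.volume 0 T := hf.intervalIntegrable _ _
    constructor
    · simpa [mul_comm] using
        intervalIntegral.integral_mono_on hT (by simp) hfT fun s _ => (hcd s).1
    · simpa [mul_comm] using
        intervalIntegral.integral_mono_on hT hfT (by simp) fun s _ => (hcd s).2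
  constructor
  · refine le_of_tendsto_of_tendsto (by simpa using tendsto_const_nhds.sub herr) hmean ?_
    filter_upwards [eventually_gt_atTop 0] with T hT
    rw [one_div, ← div_eq_inv_mul, le_div_iff₀ hT, sub_mul, div_mul_cancel₀ _ hT.ne']
    linarith [(abs_le.mp (hD T)).1, (hint T hT.le).1]
  · refine le_of_tendsto_of_tendsto hmean (by simpa using tendsto_const_nhds.add herr) ?_
    filter_upwards [eventually_gt_atTop 0] with T hT
    rw [one_div, ← div_eq_inv_mul, div_le_iff₀ hT, add_mul, div_mul_cancel₀ _ hT.ne']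
    linarith [(abs_le.mp (hD T)).2, (hint T hT.le).2]

theorem IsSolution.average_mem_Ioo {gm gp : ℝ} (hu : IsSolution g p u) (hub : IsBoundedFun u)
    (hg : Continuous g) (hgb : IsBoundedFun g) (hgmono : StrictMono g)
    (hgm : Tendsto g atBot (𝓝 gm)) (hgp : Tendsto g atTop (𝓝 gp)) (hp : Continuous p)
    (hpb : IsBoundedFun p) (hA : HasAsymptoticAverage p A) : A ∈ Ioo gm gp := by
  obtain ⟨Mg, hMg⟩ := hgb
  obtain ⟨Mp, hMp⟩ := hpb
  obtain ⟨B, hB⟩ := hub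
  have hsol := hu.isSecondOrderSol
  have hgu : Continuous fun s => g (u s) := hg.comp hsol.continuous
  have hvel : ∀ t, |deriv u t| ≤ 2 * B + (Mp + Mg) := hsol.abs_deriv_le_of_abs_le hB fun t =>
    (abs_sub _ _).trans (add_le_add (hMp t) (hMg (u t)))
  have hbal (T : ℝ) : |(∫ s in (0 : ℝ)..T, p s) - ∫ s in (0 : ℝ)..T, g (u s)| ≤
      2 * (2 * B + (Mp + Mg)) := by
    rw [← intervalIntegral.integral_sub (hp.intervalIntegrable _ _) (hgu.intervalIntegrable _ _),
      intervalIntegral.integral_eq_sub_of_hasDerivAt (fun s _ => (hsol s).2)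
        ((hp.sub hgu).intervalIntegrable _ _)]
    exact (abs_sub _ _).trans (by linarith [hvel T, hvel 0])
  obtain ⟨hlo, hhi⟩ := hA.mem_Icc_of_abs_integral_sub_le hgu (fun s =>
    ⟨hgmono.monotone (abs_le.mp (hB s)).1, hgmono.monotone (abs_le.mp (hB s)).2⟩) hbal
  constructor
  · calc gm ≤ g (-B - 1) := hgmono.monotone.le_of_tendsto hgm _
      _ < g (-B) := hgmono (sub_one_lt _)
      _ ≤ A := hlo
  · calc A ≤ g B := hhi
      _ < g (B + 1) := hgmono (lt_add_one B)
      _ ≤ gp := hgmono.monotone.ge_of_tendsto hgp _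

end Necessity

section Normalization

variable {g p : ℝ → ℝ} {x₀ A : ℝ}

lemma not_convexOn_Ici_of_isBoundedFun (hgb : IsBoundedFun g) (hgmono : StrictMono g) :
    ¬ConvexOn ℝ (Ici x₀) g := by
  intro hconv
  obtain ⟨M, hM⟩ := hgb
  have hslope : 0 < g (x₀ + 1) - g x₀ := sub_pos.mpr (hgmono (lt_add_one x₀))
  have hM₀ : 0 ≤ M := (abs_nonneg _).trans (hM 0)
  obtain ⟨L, hL⟩ : ∃ L, L = (2 * M + 1) / (g (x₀ + 1) - g x₀) := ⟨_, rfl⟩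
  have hL₀ : 0 < L := hL ▸ by positivity
  have hle := hconv.slope_mono_adjacent (z := x₀ + 1 + L) self_mem_Ici
    (mem_Ici.mpr (by linarith)) (lt_add_one x₀) (lt_add_of_pos_right _ hL₀)
  rw [add_sub_cancel_left, add_sub_cancel_left, div_one, le_div_iff₀ hL₀] at hle
  have hmul : (g (x₀ + 1) - g x₀) * L = 2 * M + 1 := hL ▸ mul_div_cancel₀ _ hslope.ne'
  linarith [(abs_le.mp (hM (x₀ + 1))).1, (abs_le.mp (hM (x₀ + 1 + L))).2]

lemma IsOnlyInflectionPoint.convex_concave (h : IsOnlyInflectionPoint g x₀)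
    (hgb : IsBoundedFun g) (hgmono : StrictMono g) :
    StrictConvexOn ℝ (Iic x₀) g ∧ StrictConcaveOn ℝ (Ici x₀) g :=
  h.resolve_right fun hflip => not_convexOn_Ici_of_isBoundedFun hgb hgmono hflip.2.convexOn

lemma deriv_pos_of_convex_concave (hg : Differentiable ℝ g) (hgmono : StrictMono g)
    (hcv : StrictConvexOn ℝ (Iic x₀) g) (hcc : StrictConcaveOn ℝ (Ici x₀) g) (x : ℝ) :
    0 < deriv g x := by
  rcases le_total x₀ x with h | h
  · exact hgmono.monotone.deriv_nonneg.trans_lt (hcc.strictAntiOn_deriv (fun y _ => hg y) h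
      (mem_Ici.mpr (h.trans (lt_add_one x).le)) (lt_add_one x))
  · exact hgmono.monotone.deriv_nonneg.trans_lt (hcv.strictMonoOn_deriv (fun y _ => hg y)
      (mem_Iic.mpr ((sub_one_lt x).le.trans h)) h (sub_one_lt x))

lemma lipschitzWith_of_convex_concave (hg : Differentiable ℝ g) (hgmono : Monotone g)
    (hcv : ConvexOn ℝ (Iic x₀) g) (hcc : ConcaveOn ℝ (Ici x₀) g) :
    LipschitzWith (deriv g x₀).toNNReal g := by
  refine lipschitzWith_of_nnnorm_deriv_le hg fun x => ?_
  rw [Real.nnnorm_of_nonneg hgmono.deriv_nonneg, ← Real.toNNReal_of_nonneg]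
  refine Real.toNNReal_le_toNNReal ?_
  rcases le_total x₀ x with h | h
  · exact hcc.antitoneOn_deriv (fun y _ => hg y) self_mem_Ici h h
  · exact hcv.monotoneOn_deriv (fun y _ => hg y) h self_mem_Iic h

lemma HasAsymptoticAverage.exists_abs_integral_sub_le (hA : HasAsymptoticAverage p A)
    (hp : Continuous p) {ε : ℝ} (hε : 0 < ε) :
    ∃ S > 0, ∀ t T, S ≤ T → |∫ s in t..t + T, (p s - A)| ≤ ε * T := by
  obtain ⟨S, hS⟩ := eventually_atTop.mp (Metric.tendstoUniformly_iff.mp hA ε hε)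
  refine ⟨max S 1, by positivity, fun t T hT => ?_⟩
  have hT₀ : 0 < T := zero_lt_one.trans_le ((le_max_right _ _).trans hT)
  have hmean := hS T ((le_max_left _ _).trans hT) t
  rw [dist_comm, Real.dist_eq] at hmean
  calc |∫ s in t..t + T, (p s - A)|
      = |(1 / T * ∫ s in t..t + T, p s) - A| * T := by
        rw [intervalIntegral.integral_sub (hp.intervalIntegrable _ _) (by simp),
          intervalIntegral.integral_const, smul_eq_mul, add_sub_cancel_left,
          ← abs_of_pos hT₀, ← abs_mul, abs_of_pos hT₀]
        congr 1
        field_simp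
    _ ≤ ε * T := by gcongr

lemma hasDerivAt_reflect (e : Bool) {g' : ℝ → ℝ} (hg : ∀ x, HasDerivAt g (g' x) x) (x : ℝ) :
    HasDerivAt (reflect e g) (g' (boolSign e * x)) x :=
  (((hg _).comp x ((hasDerivAt_id x).const_mul (boolSign e))).const_mul _).congr_deriv (by
    rw [id, mul_one, mul_comm (g' _), boolSign_mul_boolSign_mul])

lemma monotone_reflect (e : Bool) (hg : Monotone g) : Monotone (reflect e g) := fun x y hxy => by
  cases e
  · simpa [reflect, boolSign] using hg hxy
  · simpa [reflect, boolSign] using hg (neg_le_neg hxy)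

lemma lipschitzWith_reflect (e : Bool) {K : NNReal} (hg : LipschitzWith K g) :
    LipschitzWith K (reflect e g) := by
  refine LipschitzWith.of_dist_le_mul fun x y => ?_
  have := hg.dist_le_mul (boolSign e * x) (boolSign e * y)
  simpa only [reflect, Real.dist_eq, ← mul_sub, abs_boolSign_mul] using this

lemma tendsto_reflect_atTop (e : Bool) {a b : ℝ} (ha : Tendsto g atBot (𝓝 a))
    (hb : Tendsto g atTop (𝓝 b)) : Tendsto (reflect e g) atTop (𝓝 (cond e (-a) b)) := by
  cases e
  · simpa [reflect_false] using hb
  · have heq : reflect true g = fun x => -g (-x) := by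
      ext x
      simp [reflect, boolSign]
    exact heq ▸ (ha.comp tendsto_neg_atTop_atBot).neg

lemma antitoneOn_comp_boolSign_mul (e : Bool) (hmono : MonotoneOn g (Iic 0))
    (hanti : AntitoneOn g (Ici 0)) : AntitoneOn (fun x => g (boolSign e * x)) (Ici 0) := by
  intro x hx y hy hxy
  cases e
  · simpa [boolSign] using hanti hx hy hxy
  · simpa [boolSign] using hmono (mem_Iic.mpr (neg_nonpos.mpr hy))
      (mem_Iic.mpr (neg_nonpos.mpr hx)) (neg_le_neg hxy)

theorem exists_isBiNormalized {gm gp : ℝ} (hg : Differentiable ℝ g) (hgb : IsBoundedFun g)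
    (hgmono : StrictMono g) (hinfl : IsOnlyInflectionPoint g x₀) (hgm : Tendsto g atBot (𝓝 gm))
    (hgp : Tendsto g atTop (𝓝 gp)) (hp : Continuous p) (hpb : IsBoundedFun p)
    (hA : HasAsymptoticAverage p A) (hlt : A ∈ Ioo gm gp) :
    ∃ (M : ℝ) (α : Bool → ℝ) (K : NNReal), IsBiNormalized (fun x => g (x + x₀) - A)
      (fun x => deriv g (x + x₀)) (fun t => p t - A) M α K := by
  obtain ⟨hcv, hcc⟩ := hinfl.convex_concave hgb hgmono
  obtain ⟨Mg, hMg⟩ := hgb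
  obtain ⟨Mp, hMp⟩ := hpb
  have hMg₀ : 0 ≤ Mg := (abs_nonneg _).trans (hMg 0)
  have hMp₀ : 0 ≤ Mp := (abs_nonneg _).trans (hMp 0)
  have hlip := lipschitzWith_of_convex_concave hg hgmono.monotone hcv.convexOn hcc.concaveOn
  refine ⟨Mg + Mp + |A|, fun e => cond e (-(gm - A)) (gp - A), _, fun e =>
    { hasDerivAt := hasDerivAt_reflect e fun x =>
        ((hg (x + x₀)).hasDerivAt.comp_add_const x x₀).sub_const A
      mono := monotone_reflect e fun x y hxy =>
        sub_le_sub_right (hgmono.monotone (add_le_add_left hxy x₀)) A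
      lip := lipschitzWith_reflect e (K := (deriv g x₀).toNNReal) <|
        LipschitzWith.of_dist_le_mul fun x y => by
          simpa only [dist_sub_right, dist_add_right] using hlip.dist_le_mul (x + x₀) (y + x₀)
      bdd := fun x => by
        rw [reflect, abs_boolSign_mul]
        exact (abs_sub _ _).trans (by linarith [hMg (boolSign e * x + x₀)])
      anti := antitoneOn_comp_boolSign_mul (g := fun x => deriv g (x + x₀)) e
        (fun x hx y hy hxy => hcv.convexOn.monotoneOn_deriv (fun z _ => hg z) (by simpa using hx)
          (by simpa using hy) (by simpa using hxy))
        fun x hx y hy hxy => hcc.concaveOn.antitoneOn_deriv (fun z _ => hg z) (by simpa using hx)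
          (by simpa using hy) (by simpa using hxy)
      deriv_pos := fun x _ => deriv_pos_of_convex_concave hg hgmono hcv hcc _
      lim := tendsto_reflect_atTop e
        ((hgm.comp (tendsto_atBot_add_const_right _ _ tendsto_id)).sub_const A)
        ((hgp.comp (tendsto_atTop_add_const_right _ _ tendsto_id)).sub_const A)
      pos := by cases e <;> simp [hlt.1, hlt.2]
      p_cont := by fun_prop
      p_bdd := fun t => by
        rw [abs_boolSign_mul]
        exact (abs_sub _ _).trans (by linarith [hMp t])
      avg := fun ε hε => by
        simpa only [intervalIntegral.integral_const_mul, abs_boolSign_mul] using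
          hA.exists_abs_integral_sub_le hp hε }⟩

end Normalization

theorem exists_large_isSolution {g p : ℝ → ℝ} {x₀ gm gp A : ℝ} (hg : Differentiable ℝ g)
    (hgb : IsBoundedFun g) (hgmono : StrictMono g) (hinfl : IsOnlyInflectionPoint g x₀)
    (hgm : Tendsto g atBot (𝓝 gm)) (hgp : Tendsto g atTop (𝓝 gp)) (hp : Continuous p)
    (hpb : IsBoundedFun p) (hA : HasAsymptoticAverage p A) (hlt : A ∈ Ioo gm gp) (N : ℝ) :
    ∃ u : ℝ → ℝ, (IsSolution g p u ∧ IsBoundedFun u ∧ IsBoundedFun (deriv u) ∧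
      {t : ℝ | u t = x₀}.Infinite ∧ {t : ℝ | u t = 0}.Infinite) ∧ N ≤ ⨆ t : ℝ, |u t| := by
  obtain ⟨M, α, K, h⟩ := exists_isBiNormalized hg hgb hgmono hinfl hgm hgp hp hpb hA hlt
  obtain ⟨H, hH, B, W, v, v', hv, hB, hosc⟩ := h.exists_oscillatesOn_univ (|N| + |x₀|)
  have hu : IsSecondOrderSol (force g p) (fun t => v t + x₀) v' := fun t =>
    ⟨(hv t).1.add_const x₀, (hv t).2.congr_deriv (sub_sub_sub_cancel_right _ _ _)⟩
  have hub (t : ℝ) : |v t + x₀| ≤ B + |x₀| :=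
    (abs_add_le _ _).trans (add_le_add_left (hB t).1 _)
  have hderiv : deriv (fun t => v t + x₀) = v' := funext fun t => (hu t).1.deriv
  refine ⟨fun t => v t + x₀, ⟨hu.isSolution hg.continuous hp, ⟨_, hub⟩,
    ⟨B, fun t => hderiv ▸ (hB t).2⟩, ?_, ?_⟩, ?_⟩
  · simpa using hosc.infinite_setOf_eq hv.continuous (y := 0)
      (by linarith [abs_nonneg N, abs_nonneg x₀, abs_zero (α := ℝ)])
  · simpa [eq_neg_iff_add_eq_zero] using hosc.infinite_setOf_eq hv.continuous (y := -x₀)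
      (by linarith [abs_nonneg N, abs_neg x₀])
  · obtain ⟨t, -, ht⟩ := (hosc 0 (subset_univ _)).1
    calc N ≤ v t + x₀ := by linarith [neg_abs_le x₀, le_abs_self N]
      _ ≤ |v t + x₀| := le_abs_self _
      _ ≤ ⨆ t, |v t + x₀| := le_ciSup (f := fun t => |v t + x₀|) ⟨_, forall_mem_range.mpr hub⟩ t

theorem theorem1p1_general (g p : ℝ → ℝ) (x₀ gm gp A : ℝ)
    (hg : Differentiable ℝ g) (hgb : IsBoundedFun g) (hgmono : StrictMono g)
    (hinfl : IsOnlyInflectionPoint g x₀)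
    (hgm : Tendsto g atBot (𝓝 gm)) (hgp : Tendsto g atTop (𝓝 gp))
    (hp : Continuous p) (hpb : IsBoundedFun p) (hA : HasAsymptoticAverage p A) :
    ((∃ u : ℝ → ℝ, IsSolution g p u ∧ IsBoundedFun u) ↔ (gm < A ∧ A < gp)) ∧
    ((∃ u : ℝ → ℝ, IsSolution g p u ∧ IsBoundedFun u ∧ IsBoundedFun (deriv u)) ↔
      (gm < A ∧ A < gp)) ∧
    ((gm < A ∧ A < gp) →
      ∃ u : ℕ → ℝ → ℝ,
        (∀ m : ℕ, IsSolution g p (u m) ∧ IsBoundedFun (u m) ∧ IsBoundedFun (deriv (u m)) ∧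
          {t : ℝ | u m t = x₀}.Infinite ∧ {t : ℝ | u m t = 0}.Infinite) ∧
        Tendsto (fun m : ℕ => ⨆ t : ℝ, |u m t|) atTop atTop) := by
  have necessity (u : ℝ → ℝ) (hu : IsSolution g p u) (hub : IsBoundedFun u) : gm < A ∧ A < gp :=
    hu.average_mem_Ioo hub hg.continuous hgb hgmono hgm hgp hp hpb hA
  have large := exists_large_isSolution hg hgb hgmono hinfl hgm hgp hp hpb hA
  refine ⟨⟨fun ⟨u, hu, hub⟩ => necessity u hu hub, fun hlt => ?_⟩,
    ⟨fun ⟨u, hu, hub, _⟩ => necessity u hu hub, fun hlt => ?_⟩, fun hlt => ?_⟩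
  · obtain ⟨u, ⟨hu, hub, -⟩, -⟩ := large hlt 0
    exact ⟨u, hu, hub⟩
  · obtain ⟨u, ⟨hu, hub, hub', -⟩, -⟩ := large hlt 0
    exact ⟨u, hu, hub, hub'⟩
  · choose u hu hsup using fun m : ℕ => large hlt m
    exact ⟨u, hu, tendsto_atTop_mono hsup tendsto_natCast_atTop_atTop⟩

theorem theorem1p1 (g p : ℝ → ℝ) (x₀ gm gp A : ℝ)
    (hg : ContDiff ℝ 2 g) (hgb : IsBoundedFun g) (hgmono : StrictMono g)
    (hinfl : IsOnlyInflectionPoint g x₀)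
    -- `gm = g(-∞)` and `gp = g(+∞)`
    (hgm : Tendsto g atBot (𝓝 gm)) (hgp : Tendsto g atTop (𝓝 gp))
    (hp : Continuous p) (hpb : IsBoundedFun p) (hA : HasAsymptoticAverage p A) :
    ((∃ u : ℝ → ℝ, IsSolution g p u ∧ IsBoundedFun u) ↔ (gm < A ∧ A < gp)) ∧
    ((∃ u : ℝ → ℝ, IsSolution g p u ∧ IsBoundedFun u ∧ IsBoundedFun (deriv u)) ↔
      (gm < A ∧ A < gp)) ∧
    ((gm < A ∧ A < gp) →
      ∃ u : ℕ → ℝ → ℝ,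
        (∀ m : ℕ, IsSolution g p (u m) ∧ IsBoundedFun (u m) ∧ IsBoundedFun (deriv (u m)) ∧
          {t : ℝ | u m t = x₀}.Infinite ∧ {t : ℝ | u m t = 0}.Infinite) ∧
        Tendsto (fun m : ℕ => ⨆ t : ℝ, |u m t|) atTop atTop) :=
  theorem1p1_general g p x₀ gm gp A (hg.differentiable (by norm_num)) hgb hgmono hinfl hgm hgp hp
    hpb hA
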